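/- **Theorem.** In online bipartite matching, a finite set $L$ of offline vertices is known in advance and $n$ online vertices arrive one by one, each together with its neighbourhood in $L$. On the arrival of an online vertex the algorithm irrevocably either matches it to a neighbour that is still free or leaves it unmatched. Consider only instances in which every online vertex has degree at most $2$. A randomized online algorithm (a probability distribution on deterministic online algorithms, which may depend on $|L|$ and $n$) is called $c$-competitive if on every such instance the expected size of its matching is at least $c$ times the size of a maximum matching. Let $$\eta := 1-\sum_{i=1}^{\infty}\frac{1}{2^{\,2^i+i-1}} .$$ 1. The Half-Half algorithm is $\eta$-competitive. On the arrival of an online vertex, this algorithm does nothing if there is no free neighbour, matches the vertex to its free neighbour if there is exactly one, and, if there are two free neighbours, matches it to one of them chosen by an independent fair coin flip. 2. For every $c>\eta$, no randomized (in particular, no deterministic) online algorithm is $c$-competitive. 3. $|\eta-0.717772|<5\cdot 10^{-7}$. 4. The optimal ratio is strictly larger for fractional matching on the same instances. There, on the arrival of an online vertex $j$, a deterministic algorithm irrevocably assigns weights $x_{ij}\ge 0$ to the edges at $j$, subject to $\sum_i x_{ij}\le 1$ for every $j$ and $\sum_j x_{ij}\le 1$ for every $i\in L$, and it is $c$-competitive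 if on every instance $\sum_{i,j}x_{ij}$ is at least $c$ times the size of a maximum matching. There is a $\tfrac34$-competitive fractional online algorithm, for $c>\tfrac34$ there is no $c$-competitive one, and $\eta<\tfrac34$. -/

import Mathlib

namespace OnlineMatching

/-- An instance of online bipartite matching with `m` offline vertices `Fin m` (known in advance) and
`n` online vertices `Fin n`, arriving in the order `0, 1, …, n - 1`.  The online vertex `j` arrives
together with its neighbourhood `nbhd j`, which has at most two elements. -/
@[ext]
structure Instance (m n : ℕ) where
  nbhd : Fin n → Finset (Fin m)
  degree_le_two : ∀ j, (nbhd j).card ≤ 2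

/-- Two instances look the same up to and including the arrival of the online vertex `j`. -/
def Instance.AgreeUpTo {m n : ℕ} (G H : Instance m n) (j : Fin n) : Prop :=
  ∀ k, k ≤ j → G.nbhd k = H.nbhd k

/-- `M` assigns to each online vertex a partner (`some i`) or leaves it unmatched (`none`).  It is a
matching of `G` if it uses only edges of `G` and no offline vertex is used twice. -/
def IsMatching {m n : ℕ} (G : Instance m n) (M : Fin n → Option (Fin m)) : Prop :=
  (∀ j i, M j = some i → i ∈ G.nbhd j) ∧
  (∀ j k i, M j = some i → M k = some i → j = k)

/-- The number of edges of a matching. -/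
def size {m n : ℕ} (M : Fin n → Option (Fin m)) : ℕ :=
  (Finset.univ.filter fun j => (M j).isSome).card

open Classical in
/-- The size of a maximum matching of `G`. -/
noncomputable def opt {m n : ℕ} (G : Instance m n) : ℕ :=
  (Finset.univ.filter fun M : Fin n → Option (Fin m) => IsMatching G M).sup size

/-- A deterministic online algorithm for instances with `m` offline and `n` online vertices (it may
depend on `m` and `n`): it always outputs a matching, and the irrevocable decision on the online
vertex `j` depends only on what has been revealed when `j` arrives. -/
@[ext]
structure DetAlgorithm (m n : ℕ) where
  run : Instance m n → Fin n → Option (Fin m)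
  isMatching : ∀ G, IsMatching G (run G)
  online : ∀ G H j, G.AgreeUpTo H j → run G j = run H j

/-- A randomized online algorithm is a probability distribution on deterministic online algorithms.
(For fixed `m` and `n` there are only finitely many of these, so discrete distributions suffice.) -/
abbrev RandAlgorithm (m n : ℕ) := PMF (DetAlgorithm m n)

/-- The distribution of the matching produced by `A` on the instance `G`. -/
noncomputable def RandAlgorithm.output {m n : ℕ} (A : RandAlgorithm m n) (G : Instance m n) :
    PMF (Fin n → Option (Fin m)) :=
  A.map fun D => D.run G

/-- The expected size of the matching produced by `A` on the instance `G`. -/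
noncomputable def RandAlgorithm.expectedSize {m n : ℕ} (A : RandAlgorithm m n) (G : Instance m n) :
    ℝ :=
  ∑ M : Fin n → Option (Fin m), (A.output G M).toReal * (size M : ℝ)

/-- `A` (one randomized online algorithm for each number of offline and online vertices) is
`c`-competitive: on every instance the expected size of its matching is at least `c` times the
optimum. -/
def IsCompetitive (c : ℝ) (A : ∀ m n : ℕ, RandAlgorithm m n) : Prop :=
  ∀ (m n : ℕ) (G : Instance m n), c * (opt G : ℝ) ≤ (A m n).expectedSize G

/-- The choice of Half-Half on the set `free` of free neighbours: no match if it is empty, otherwise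
its smaller or its larger element according to a coin flip.  For one free neighbour the coin is
irrelevant; for two free neighbours a fair coin gives each of them with probability one half. -/
def halfHalfChoice {m : ℕ} (coin : Bool) (free : Finset (Fin m)) : Option (Fin m) :=
  if h : free.Nonempty then some (if coin then free.min' h else free.max' h) else none

/-- The set of offline vertices matched by Half-Half after the first `t` arrivals, where `coin j` is
the coin flipped for the online vertex `j`. -/
def halfHalfUsed {m n : ℕ} (coin : Fin n → Bool) (G : Instance m n) : ℕ → Finset (Fin m)
  | 0 => ∅
  | t + 1 =>
    if h : t < n then
      halfHalfUsed coin G t ∪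
        (halfHalfChoice (coin ⟨t, h⟩) (G.nbhd ⟨t, h⟩ \ halfHalfUsed coin G t)).toFinset
    else halfHalfUsed coin G t

/-- The decision of Half-Half on the online vertex `j`. -/
def halfHalfRun {m n : ℕ} (coin : Fin n → Bool) (G : Instance m n) (j : Fin n) :
    Option (Fin m) :=
  halfHalfChoice (coin j) (G.nbhd j \ halfHalfUsed coin G j)

theorem halfHalfChoice_mem {m : ℕ} {coin : Bool} {free : Finset (Fin m)} {i : Fin m}
    (h : halfHalfChoice coin free = some i) : i ∈ free := by
  unfold halfHalfChoice at h
  split_ifs at h with h1 h2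
  · rw [← Option.some.inj h]; exact Finset.min'_mem _ _
  · rw [← Option.some.inj h]; exact Finset.max'_mem _ _

theorem halfHalfUsed_succ {m n : ℕ} (coin : Fin n → Bool) (G : Instance m n) (j : Fin n) :
    halfHalfUsed coin G (j + 1) =
      halfHalfUsed coin G j ∪ (halfHalfRun coin G j).toFinset := by
  simp [halfHalfUsed, halfHalfRun]

theorem halfHalfUsed_mono {m n : ℕ} (coin : Fin n → Bool) (G : Instance m n) :
    Monotone (halfHalfUsed coin G) := by
  refine monotone_nat_of_le_succ fun t => ?_
  rw [halfHalfUsed]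
  split_ifs
  · exact Finset.subset_union_left
  · exact le_rfl

theorem halfHalfRun_notMem {m n : ℕ} {coin : Fin n → Bool} {G : Instance m n} {j k : Fin n}
    (hjk : j < k) {i : Fin m} (hj : halfHalfRun coin G j = some i) :
    halfHalfRun coin G k ≠ some i := by
  intro hk
  have h1 : i ∈ halfHalfUsed coin G (j + 1) := by
    rw [halfHalfUsed_succ, hj]; simp
  exact (Finset.mem_sdiff.1 (halfHalfChoice_mem hk)).2
    (halfHalfUsed_mono coin G (Nat.succ_le_of_lt hjk) h1)

theorem halfHalfUsed_congr {m n : ℕ} (coin : Fin n → Bool) (G H : Instance m n) (t : ℕ)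
    (h : ∀ k : Fin n, (k : ℕ) < t → G.nbhd k = H.nbhd k) :
    halfHalfUsed coin G t = halfHalfUsed coin H t := by
  induction t with
  | zero => rfl
  | succ t ih =>
    have ih' := ih fun k hk => h k (Nat.lt_succ_of_lt hk)
    by_cases ht : t < n
    · simp only [halfHalfUsed, ht, dite_true, ih', h ⟨t, ht⟩ (Nat.lt_succ_self t)]
    · simp only [halfHalfUsed, ht, dite_false, ih']

/-- Half-Half with a fixed sequence of coin flips. -/
def halfHalfDet {m n : ℕ} (coin : Fin n → Bool) : DetAlgorithm m n where
  run := halfHalfRun coin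
  isMatching G := by
    refine ⟨fun j i h => (Finset.mem_sdiff.1 (halfHalfChoice_mem h)).1, fun j k i hj hk => ?_⟩
    rcases lt_trichotomy j k with h | h | h
    · exact absurd hk (halfHalfRun_notMem h hj)
    · exact h
    · exact absurd hj (halfHalfRun_notMem h hk)
  online G H j h := by
    have h1 := halfHalfUsed_congr coin G H j fun k hk => h k (le_of_lt hk)
    simp only [halfHalfRun, h1, h j le_rfl]

/-- The Half-Half algorithm: a free neighbour is chosen whenever there is one, and by an independent
fair coin flip when there are two. -/
noncomputable def halfHalf (m n : ℕ) : RandAlgorithm m n :=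
  (PMF.uniformOfFintype (Fin n → Bool)).map halfHalfDet

/-- `η = 1 - ∑_{i ≥ 1} 2 ^ (-(2 ^ i + i - 1))`; the summation index is shifted by one. -/
noncomputable def eta : ℝ := 1 - ∑' i : ℕ, 1 / (2 : ℝ) ^ (2 ^ (i + 1) + i)

/-- A deterministic online algorithm for fractional matching: `run G j i` is the fraction to which
the edge between the online vertex `j` and the offline vertex `i` is used. -/
structure FracAlgorithm (m n : ℕ) where
  run : Instance m n → Fin n → Fin m → ℝ
  nonneg : ∀ G j i, 0 ≤ run G j i
  supported : ∀ G j i, i ∉ G.nbhd j → run G j i = 0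
  online_sum_le_one : ∀ G j, ∑ i, run G j i ≤ 1
  offline_sum_le_one : ∀ G i, ∑ j, run G j i ≤ 1
  online : ∀ G H j, G.AgreeUpTo H j → run G j = run H j

/-- `A` (one fractional online algorithm for each number of offline and online vertices) is
`c`-competitive: on every instance the total weight of its fractional matching is at least `c` times
the optimum. -/
def FracIsCompetitive (c : ℝ) (A : ∀ m n : ℕ, FracAlgorithm m n) : Prop :=
  ∀ (m n : ℕ) (G : Instance m n), c * (opt G : ℝ) ≤ ∑ j, ∑ i, (A m n).run G j i

end OnlineMatching

namespace OnlineMatching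

/-! Degree at most 2 turns online vertices into edges (or loops) of a growing graph on the offline
vertices. A matching covers at most |C| - 1 vertices of a tree component C and at most |C| of any
other. So for a ratio `θ` the expected unmatched weight must stay below about |C|(1 - θ), and a tree
component has some slack. The invariant measures this slack by `φ (p w)`, where `p w` is the free
weight of a vertex `w`. It is required for every `w` because the next edge may attach anywhere.
`mul_opt_le_of_potential` reduces both positive results to inequalities about one arrival.

For Half-Half, `p` is the probability of being free. Joint freeness is negatively correlated
(`freeProb_union_le`), and `φ x = x - 2 * rho (x / 2)` absorbs a merge by AM-GM (`add_rho_le`); its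
value at 1 is `η`. For the balancing fractional algorithm, `p` is the remaining capacity and `φ x =
min x (1 / 4 + x / 2)`.

For the upper bound, a random binary tree plays against the algorithm: each online vertex joins the
active vertices of two subtrees, and afterwards a fair coin decides which of them stays active. The
coin makes the choice of the algorithm irrelevant, so free active vertices survive at least as often
as under Half-Half with greedy play (`TreeStrategy.prod_le_sum_freeAt`). Surviving free vertices are
lost matches, while matching every online vertex to the retired vertex is always possible. Averaging
over the coins bounds every randomized algorithm, and perfect trees of growing height give `η` in
the limit. For fractional algorithms a two-step instance already gives 3/4. -/

theorem Instance.nbhd_eq_pair {m n : ℕ} (G : Instance m n) {j : Fin n} {u v : Fin m}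
    (hu : u ∈ G.nbhd j) (hv : v ∈ G.nbhd j) (huv : u ≠ v) : G.nbhd j = {u, v} := by
  refine (Finset.eq_of_subset_of_card_le ?_ ?_).symm
  · simp [Finset.insert_subset_iff, hu, hv]
  · rw [Finset.card_pair huv]; exact G.degree_le_two j

theorem Instance.nbhd_eq_of_mem {m n : ℕ} {G : Instance m n} {j : Fin n} {u : Fin m}
    (hu : u ∈ G.nbhd j) : G.nbhd j = {u} ∨ ∃ v, u ≠ v ∧ G.nbhd j = {u, v} := by
  by_cases hv : ∃ v ∈ G.nbhd j, u ≠ v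
  · obtain ⟨v, hv, huv⟩ := hv
    exact Or.inr ⟨v, huv, G.nbhd_eq_pair hu hv huv⟩
  · push Not at hv
    left
    ext x
    rw [Finset.mem_singleton]
    exact ⟨fun h => (hv x h).symm, fun h => h ▸ hu⟩

/-! ### Maximum matchings and the potential argument on components -/

theorem exists_isMatching_size_eq_opt {m n : ℕ} (G : Instance m n) :
    ∃ M, IsMatching G M ∧ size M = opt G := by
  classical
  have hne : (Finset.univ.filter fun M : Fin n → Option (Fin m) => IsMatching G M).Nonempty :=
    ⟨fun _ => none, Finset.mem_filter.2 ⟨Finset.mem_univ _, by simp, by simp⟩⟩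
  obtain ⟨M, hM, h⟩ := Finset.exists_mem_eq_sup _ hne size
  refine ⟨M, (Finset.mem_filter.1 hM).2, ?_⟩
  rw [← h, opt]

theorem IsMatching.size_le_opt {m n : ℕ} {G : Instance m n} {M : Fin n → Option (Fin m)}
    (hM : IsMatching G M) : size M ≤ opt G := by
  classical
  have : size M ≤ (Finset.univ.filter fun M : Fin n → Option (Fin m) => IsMatching G M).sup size :=
    Finset.le_sup (by simpa using hM)
  rw [opt]
  convert this

/-- The number of online vertices before time `t` that `M` matches into the class `c` of `κ`. -/
def matchedInto {m n : ℕ} (M : Fin n → Option (Fin m)) (κ : Fin m → Fin m) (t : ℕ) (c : Fin m) :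
    ℕ :=
  (Finset.univ.filter fun j : Fin n => (j : ℕ) < t ∧ (M j).map κ = some c).card

theorem IsMatching.matchedInto_le {m n : ℕ} {G : Instance m n} {M : Fin n → Option (Fin m)}
    (hM : IsMatching G M) (κ : Fin m → Fin m) (t : ℕ) (c : Fin m) :
    matchedInto M κ t c ≤ (Finset.univ.filter fun x => κ x = c).card := by
  rw [← Finset.card_image_of_injective (Finset.univ.filter fun x => κ x = c)
    (Option.some_injective (Fin m))]
  refine Finset.card_le_card_of_injOn M (fun j hj => ?_) (fun j hj k hk h => ?_)
  · simp only [Finset.coe_filter, Set.mem_ofPred_eq, Finset.mem_univ, true_and,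
      Option.map_eq_some_iff] at hj
    obtain ⟨-, i, h1, h2⟩ := hj
    simp [h1, h2]
  · simp only [Finset.coe_filter, Set.mem_ofPred_eq, Finset.mem_univ, true_and,
      Option.map_eq_some_iff] at hj
    obtain ⟨-, i, h1, -⟩ := hj
    exact hM.2 j k i h1 (h ▸ h1)

theorem matchedInto_succ_le {m n : ℕ} (M : Fin n → Option (Fin m)) (κ : Fin m → Fin m) (t : ℕ)
    (c : Fin m) : matchedInto M κ (t + 1) c ≤ matchedInto M κ t c + 1 := by
  by_cases ht : t < n
  · refine (Finset.card_le_card (t := insert ⟨t, ht⟩ (Finset.univ.filter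
      fun j : Fin n => (j : ℕ) < t ∧ (M j).map κ = some c)) fun j hj => ?_).trans
      (Finset.card_insert_le _ _)
    simp only [Finset.mem_filter, Finset.mem_univ, true_and, Finset.mem_insert, Fin.ext_iff]
      at hj ⊢
    by_cases h : (j : ℕ) = t
    · exact Or.inl h
    · exact Or.inr ⟨by omega, hj.2⟩
  · refine (Finset.card_le_card fun j hj => ?_).trans (Nat.le_succ _)
    simp only [Finset.mem_filter, Finset.mem_univ, true_and] at hj ⊢
    exact ⟨by omega, hj.2⟩

theorem matchedInto_succ_of_ne {m n : ℕ} (M : Fin n → Option (Fin m)) (κ : Fin m → Fin m)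
    (j : Fin n) (c : Fin m) (h : (M j).map κ ≠ some c) :
    matchedInto M κ (j + 1) c = matchedInto M κ j c := by
  unfold matchedInto
  congr 1
  ext k
  simp only [Finset.mem_filter, Finset.mem_univ, true_and]
  refine ⟨fun hk => ⟨?_, hk.2⟩, fun hk => ⟨by omega, hk.2⟩⟩
  have : k ≠ j := fun e => h (e ▸ hk.2)
  rw [Ne, Fin.ext_iff] at this
  omega

/-- The components of the graph with vertex set `Fin m` whose edges are the neighbourhoods that have
arrived before time `t` are the classes of a labelling `κ`; `T` is the set of labels of acyclic
components.  On an acyclic component the total weight `p` exceeds the share `1 - θ` per vertex by at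
most `φ (p w)`, for every vertex `w`; on the other components it does not exceed it. -/
def ComponentBound {m n : ℕ} (M : Fin n → Option (Fin m)) (θ : ℝ) (φ : ℝ → ℝ) (t : ℕ)
    (p : Fin m → ℝ) (κ : Fin m → Fin m) (T : Finset (Fin m)) : Prop :=
  (∀ c ∈ T, matchedInto M κ t c + 1 ≤ (Finset.univ.filter fun x => κ x = c).card ∧
    ∀ w, κ w = c → ∑ x ∈ Finset.univ.filter (fun x => κ x = c), p x ≤
      (Finset.univ.filter fun x => κ x = c).card * (1 - θ) + φ (p w)) ∧
  (∀ c ∉ T, ∑ x ∈ Finset.univ.filter (fun x => κ x = c), p x ≤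
      (Finset.univ.filter fun x => κ x = c).card * (1 - θ))

theorem sum_eq_sub_drop {m : ℕ} {p q : Fin m → ℝ} {s F : Finset (Fin m)}
    (hfix : ∀ x ∉ s, q x = p x) (hF : s ⊆ F) :
    ∑ x ∈ F, q x = ∑ x ∈ F, p x - ∑ x ∈ s, (p x - q x) := by
  have : ∑ x ∈ s, (p x - q x) = ∑ x ∈ F, (p x - q x) :=
    Finset.sum_subset hF fun x _ hx => by rw [hfix x hx, sub_self]
  rw [this, Finset.sum_sub_distrib]
  ring

/-- A loop or a cycle-closing edge destroys the tree, hence its slack must be repaid. The drop of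
the total weight is at least `p u ≥ φ (p u)`, which pays for it. -/
theorem ComponentBound.closing {m n : ℕ} {G : Instance m n} {M : Fin n → Option (Fin m)}
    (hM : IsMatching G M) {θ : ℝ} {φ : ℝ → ℝ} {j : Fin n} {p q : Fin m → ℝ} {κ : Fin m → Fin m}
    {T : Finset (Fin m)} (h : ComponentBound M θ φ j p κ T) (hp : ∀ x, 0 ≤ p x)
    (hφ : ∀ x, 0 ≤ x → φ x ≤ x) (hfix : ∀ x ∉ G.nbhd j, q x = p x)
    (hdrop : ∀ u ∈ G.nbhd j, p u ≤ ∑ x ∈ G.nbhd j, (p x - q x))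
    {u : Fin m} (hu : u ∈ G.nbhd j) (hκ : ∀ x ∈ G.nbhd j, κ x = κ u) :
    ComponentBound M θ φ (j + 1 : ℕ) q κ (T.erase (κ u)) := by
  have hsum : ∀ c, c ≠ κ u → ∑ x ∈ Finset.univ.filter (fun x => κ x = c), q x =
      ∑ x ∈ Finset.univ.filter (fun x => κ x = c), p x := fun c hc => by
    refine Finset.sum_congr rfl fun x hx => hfix x fun hx' => hc ?_
    rw [← hκ x hx', (Finset.mem_filter.1 hx).2]
  refine ⟨fun c hc => ?_, fun c hc => ?_⟩
  · obtain ⟨hcu, hcT⟩ := Finset.mem_erase.1 hc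
    obtain ⟨h1, h2⟩ := h.1 c hcT
    refine ⟨?_, fun w hw => ?_⟩
    · rwa [matchedInto_succ_of_ne]
      intro hMj
      obtain ⟨i, hi, rfl⟩ := Option.map_eq_some_iff.1 hMj
      exact hcu (hκ i (hM.1 j i hi))
    · rw [hsum c hcu, hfix w fun hw' => hcu (hw ▸ hκ w hw')]
      exact h2 w hw
  · by_cases hcu : c = κ u
    · subst hcu
      rw [sum_eq_sub_drop hfix fun x hx => by simp [hκ x hx]]
      have hd := hdrop u hu
      by_cases hT : κ u ∈ T
      · linarith [(h.1 _ hT).2 u rfl, hφ _ (hp u)]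
      · linarith [h.2 _ hT, hp u]
    · rw [hsum c hcu]
      exact h.2 c fun hT => hc (Finset.mem_erase.2 ⟨hcu, hT⟩)

/-- Joining two trees leaves a tree, whose slack must be bounded at every vertex: `hmerge` handles
the ends of the new edge, `hdrop` all other vertices. If one side is not a tree, neither is the
union, and `hdrop` repays the slack of the other side. -/
theorem ComponentBound.merging {m n : ℕ} {G : Instance m n} {M : Fin n → Option (Fin m)}
    (hM : IsMatching G M) {θ : ℝ} {φ : ℝ → ℝ} {j : Fin n} {p q : Fin m → ℝ} {κ : Fin m → Fin m}
    {T : Finset (Fin m)} (h : ComponentBound M θ φ j p κ T) (hp : ∀ x, 0 ≤ p x)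
    (hφ : ∀ x, 0 ≤ x → φ x ≤ x) (hfix : ∀ x ∉ G.nbhd j, q x = p x)
    (hdrop : ∀ u ∈ G.nbhd j, p u ≤ ∑ x ∈ G.nbhd j, (p x - q x))
    (hmerge : ∀ u ∈ G.nbhd j, ∀ v ∈ G.nbhd j, u ≠ v →
      φ (p u) + φ (p v) - ∑ x ∈ G.nbhd j, (p x - q x) ≤ φ (q u))
    {u v : Fin m} (hu : u ∈ G.nbhd j) (hv : v ∈ G.nbhd j) (hκ : κ u ≠ κ v) :
    ∃ κ' T', ComponentBound M θ φ (j + 1 : ℕ) q κ' T' := by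
  have huv : u ≠ v := fun e => hκ (e ▸ rfl)
  have hn : G.nbhd j = {u, v} := G.nbhd_eq_pair hu hv huv
  set κ' : Fin m → Fin m := fun x => if κ x = κ v then κ u else κ x with hκ'
  set D := ∑ x ∈ G.nbhd j, (p x - q x) with hD
  have hFu : (Finset.univ.filter fun x => κ' x = κ u) =
      (Finset.univ.filter fun x => κ x = κ u) ∪ (Finset.univ.filter fun x => κ x = κ v) := by
    ext x
    simp only [hκ', Finset.mem_filter, Finset.mem_univ, true_and, Finset.mem_union]
    split_ifs with h1 <;> simp [h1]
  have hdisj : Disjoint (Finset.univ.filter fun x => κ x = κ u)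
      (Finset.univ.filter fun x => κ x = κ v) := by
    refine Finset.disjoint_left.2 fun x h1 h2 => hκ ?_
    rw [← (Finset.mem_filter.1 h1).2, (Finset.mem_filter.1 h2).2]
  have hcard := Finset.card_union_of_disjoint hdisj
  rw [← hFu] at hcard
  have hsumu : ∑ x ∈ Finset.univ.filter (fun x => κ' x = κ u), q x =
      ∑ x ∈ Finset.univ.filter (fun x => κ x = κ u), p x +
      ∑ x ∈ Finset.univ.filter (fun x => κ x = κ v), p x - D := by
    rw [sum_eq_sub_drop hfix, hFu, Finset.sum_union hdisj]
    rw [hn, hFu]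
    simp [Finset.insert_subset_iff]
  have hFv : (Finset.univ.filter fun x => κ' x = κ v) = ∅ := by
    refine Finset.filter_eq_empty_iff.2 fun x _ => ?_
    simp only [hκ']
    split_ifs with h1
    · exact hκ
    · exact h1
  have hFc : ∀ c, c ≠ κ u → c ≠ κ v → (Finset.univ.filter fun x => κ' x = c) =
      (Finset.univ.filter fun x => κ x = c) := fun c hcu hcv => by
    ext x
    simp only [hκ', Finset.mem_filter, Finset.mem_univ, true_and]
    split_ifs with h1
    · exact ⟨fun e => absurd e.symm hcu, fun e => absurd (e.symm.trans h1) hcv⟩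
    · rfl
  have hmapc : ∀ c, c ≠ κ u → c ≠ κ v → ∀ o : Option (Fin m),
      o.map κ' = some c ↔ o.map κ = some c := fun c hcu hcv o => by
    cases o with
    | none => simp
    | some x => simpa using Finset.ext_iff.1 (hFc c hcu hcv) x
  have hsumc : ∀ c, c ≠ κ u → c ≠ κ v → ∑ x ∈ Finset.univ.filter (fun x => κ' x = c), q x =
      ∑ x ∈ Finset.univ.filter (fun x => κ x = c), p x := fun c hcu hcv => by
    rw [hFc c hcu hcv]
    refine Finset.sum_congr rfl fun x hx => hfix x fun hx' => ?_
    have hxc := (Finset.mem_filter.1 hx).2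
    rw [hn, Finset.mem_insert, Finset.mem_singleton] at hx'
    rcases hx' with rfl | rfl
    · exact hcu hxc.symm
    · exact hcv hxc.symm
  have hother : ∀ c ∈ T, c ≠ κ u → c ≠ κ v →
      matchedInto M κ' (j + 1 : ℕ) c + 1 ≤ (Finset.univ.filter fun x => κ' x = c).card ∧
      ∀ w, κ' w = c → ∑ x ∈ Finset.univ.filter (fun x => κ' x = c), q x ≤
        (Finset.univ.filter fun x => κ' x = c).card * (1 - θ) + φ (q w) := fun c hc hcu hcv => by
    obtain ⟨h1, h2⟩ := h.1 c hc
    refine ⟨?_, fun w hw => ?_⟩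
    · rw [hFc c hcu hcv, matchedInto_succ_of_ne]
      · simpa only [matchedInto, hmapc c hcu hcv] using h1
      · rw [Ne, hmapc c hcu hcv]
        intro hMj
        obtain ⟨i, hi, hic⟩ := Option.map_eq_some_iff.1 hMj
        have := hM.1 j i hi
        rw [hn, Finset.mem_insert, Finset.mem_singleton] at this
        rcases this with rfl | rfl
        · exact hcu hic.symm
        · exact hcv hic.symm
    · have hw' : κ w = c := by simpa using Finset.ext_iff.1 (hFc c hcu hcv) w |>.1 (by simpa using hw)
      rw [hsumc c hcu hcv, hFc c hcu hcv, hfix w]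
      · exact h2 w hw'
      · rw [hn, Finset.mem_insert, Finset.mem_singleton]
        rintro (rfl | rfl)
        · exact hcu hw'.symm
        · exact hcv hw'.symm
  have hother' : ∀ c ∉ T, c ≠ κ u → c ≠ κ v →
      ∑ x ∈ Finset.univ.filter (fun x => κ' x = c), q x ≤
        (Finset.univ.filter fun x => κ' x = c).card * (1 - θ) := fun c hc hcu hcv => by
    rw [hsumc c hcu hcv, hFc c hcu hcv]
    exact h.2 c hc
  have hdu := hdrop u hu
  have hdv := hdrop v hv
  have hφu := hφ _ (hp u)
  have hφv := hφ _ (hp v)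
  have hcard' : ((Finset.univ.filter fun x => κ' x = κ u).card : ℝ) =
      (Finset.univ.filter fun x => κ x = κ u).card +
      (Finset.univ.filter fun x => κ x = κ v).card := by
    rw [hcard]; push_cast; rfl
  by_cases hTT : κ u ∈ T ∧ κ v ∈ T
  · obtain ⟨hTu, hTv⟩ := hTT
    obtain ⟨a1, a2⟩ := h.1 _ hTu
    obtain ⟨b1, b2⟩ := h.1 _ hTv
    refine ⟨κ', T.erase (κ v), fun c hc => ?_, fun c hc => ?_⟩
    · obtain ⟨hcv, hcT⟩ := Finset.mem_erase.1 hc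
      by_cases hcu : c = κ u
      · subst hcu
        refine ⟨?_, fun w hw => ?_⟩
        -- The counts add up to at most |C| - 1 + |C'| - 1, and the new edge adds at most one.
        · have hle : matchedInto M κ' j (κ u) ≤
              matchedInto M κ j (κ u) + matchedInto M κ j (κ v) := by
            refine (Finset.card_le_card fun k hk => ?_).trans (Finset.card_union_le _ _)
            simp only [Finset.mem_filter, Finset.mem_univ, true_and, Finset.mem_union] at hk ⊢
            obtain ⟨i, hi, hiu⟩ := Option.map_eq_some_iff.1 hk.2
            have := Finset.ext_iff.1 hFu i |>.1 (by simpa using hiu)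
            simp only [Finset.mem_filter, Finset.mem_univ, true_and, Finset.mem_union] at this
            simpa [hi, hk.1] using this
          have := matchedInto_succ_le M κ' j (κ u)
          omega
        · rw [hsumu, hcard']
          by_cases hwu : w = u
          · subst hwu
            linarith [hmerge w hu v hv huv, a2 w rfl, b2 v rfl]
          by_cases hwv : w = v
          · subst hwv
            linarith [hmerge w hv u hu huv.symm, a2 u rfl, b2 w rfl]
          -- Away from the new edge, the slack of the tree containing `w` is kept, and that of the
          -- other tree, at most the free weight of its endpoint, is covered by the drop.
          have hwfix : q w = p w := hfix w (by simp [hn, hwu, hwv])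
          rw [hwfix]
          have := Finset.ext_iff.1 hFu w |>.1 (by simpa using hw)
          simp only [Finset.mem_filter, Finset.mem_univ, true_and, Finset.mem_union] at this
          rcases this with h1 | h1
          · linarith [a2 w h1, b2 v rfl]
          · linarith [b2 w h1, a2 u rfl]
      · exact hother c hcT hcu hcv
    · by_cases hcv : c = κ v
      · subst hcv; simp [hFv]
      · have hcT : c ∉ T := fun hT => hc (Finset.mem_erase.2 ⟨hcv, hT⟩)
        exact hother' c hcT (fun e => hcT (e ▸ hTu)) hcv
  · refine ⟨κ', (T.erase (κ v)).erase (κ u), fun c hc => ?_, fun c hc => ?_⟩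
    · simp only [Finset.mem_erase] at hc
      exact hother c hc.2.2 hc.1 hc.2.1
    · by_cases hcu : c = κ u
      · subst hcu
        rw [hsumu, hcard']
        have hpu := hp u
        have hpv := hp v
        by_cases hTu : κ u ∈ T
        · have hTv : κ v ∉ T := fun e => hTT ⟨hTu, e⟩
          linarith [(h.1 _ hTu).2 u rfl, h.2 _ hTv]
        · by_cases hTv : κ v ∈ T
          · linarith [(h.1 _ hTv).2 v rfl, h.2 _ hTu]
          · linarith [h.2 _ hTv, h.2 _ hTu]
      · by_cases hcv : c = κ v
        · subst hcv; simp [hFv]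
        · exact hother' c (fun hT => hc (by simp [hcu, hcv, hT])) hcu hcv

/-- A potential function argument.  The weight `p t x` of the offline vertex `x` at time `t` is the
probability that `x` is free, or the fraction of `x` that is free. -/
theorem mul_opt_le_of_potential {m n : ℕ} (G : Instance m n) {θ : ℝ} {φ : ℝ → ℝ}
    {p : ℕ → Fin m → ℝ} (hθ : 0 ≤ θ) (hp0 : ∀ x, p 0 x = 1) (hφ1 : φ 1 = θ)
    (hp : ∀ t x, 0 ≤ p t x) (hφ : ∀ x, 0 ≤ x → φ x ≤ x) (hφθ : ∀ t x, φ (p t x) ≤ θ)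
    (hfix : ∀ (j : Fin n), ∀ x ∉ G.nbhd j, p (j + 1) x = p j x)
    (hdrop : ∀ (j : Fin n), ∀ u ∈ G.nbhd j, p j u ≤ ∑ x ∈ G.nbhd j, (p j x - p (j + 1) x))
    (hmerge : ∀ (j : Fin n), ∀ u ∈ G.nbhd j, ∀ v ∈ G.nbhd j, u ≠ v →
      φ (p j u) + φ (p j v) - ∑ x ∈ G.nbhd j, (p j x - p (j + 1) x) ≤ φ (p (j + 1) u)) :
    θ * opt G ≤ m - ∑ x, p n x := by
  obtain ⟨M, hM, hMopt⟩ := exists_isMatching_size_eq_opt G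
  have key : ∀ t ≤ n, ∃ κ T, ComponentBound M θ φ t (p t) κ T := by
    intro t
    induction t with
    | zero =>
      intro _
      -- Initially every vertex is a tree by itself, and the bound is the equality `1 = (1 - θ) + φ
      -- 1`.
      refine ⟨id, Finset.univ, fun c _ => ⟨by simp [matchedInto, Finset.filter_eq'], ?_⟩, by simp⟩
      intro w hw
      simp [Finset.filter_eq', hp0, hφ1]
    | succ t ih =>
      intro ht
      obtain ⟨κ, T, h⟩ := ih (by omega)
      set j : Fin n := ⟨t, ht⟩ with hj
      have hfj : ∀ x ∉ G.nbhd j, p (t + 1) x = p t x := hfix j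
      rcases (G.nbhd j).eq_empty_or_nonempty with he | ⟨u, hu⟩
      · have hpp : p (t + 1) = p t := funext fun x => hfj x (by simp [he])
        refine ⟨κ, T, ?_⟩
        have hmi : ∀ c, matchedInto M κ (t + 1) c = matchedInto M κ t c := fun c => by
          refine matchedInto_succ_of_ne M κ j c fun hMj => ?_
          obtain ⟨i, hi, -⟩ := Option.map_eq_some_iff.1 hMj
          simpa [he] using hM.1 j i hi
        simpa only [ComponentBound, hpp, hmi] using h
      · by_cases hκ : ∀ x ∈ G.nbhd j, κ x = κ u
        · exact ⟨κ, _, ComponentBound.closing hM (j := j) h (hp t) hφ hfj (hdrop j) hu hκ⟩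
        · push Not at hκ
          obtain ⟨v, hv, huv⟩ := hκ
          exact ComponentBound.merging hM (j := j) h (hp t) hφ hfj (hdrop j) (hmerge j) hv hu huv
  obtain ⟨κ, T, h⟩ := key n le_rfl
  have hsize : size M = ∑ c, matchedInto M κ n c := by
    have : ∀ c, matchedInto M κ n c = ((Finset.univ.filter fun j => (M j).isSome).filter
        fun j => (M j).map κ = some c).card := fun c => by
      unfold matchedInto
      congr 1
      ext j
      simp only [Finset.mem_filter, Finset.mem_univ, true_and, j.2]
      refine ⟨fun h => ⟨?_, h⟩, fun h => h.2⟩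
      obtain ⟨i, hi, -⟩ := Option.map_eq_some_iff.1 h
      simp [hi]
    simp only [this, Finset.card_filter, Finset.sum_filter]
    rw [size, Finset.card_filter, Finset.sum_comm]
    refine Finset.sum_congr rfl fun j _ => ?_
    cases hMj : M j with
    | none => simp
    | some i => simp
  have hcardm : ∑ c, ((Finset.univ.filter fun x => κ x = c).card : ℝ) = m := by
    have := Finset.card_eq_sum_card_fiberwise (s := (Finset.univ : Finset (Fin m)))
      (t := Finset.univ) (f := κ) (fun _ _ => by simp)
    rw [Finset.card_univ, Fintype.card_fin] at this
    exact_mod_cast this.symm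
  have hbound : ∀ c, θ * (matchedInto M κ n c : ℝ) ≤
      (Finset.univ.filter fun x => κ x = c).card -
        ∑ x ∈ Finset.univ.filter (fun x => κ x = c), p n x := fun c => by
    by_cases hc : c ∈ T
    · obtain ⟨h1, h2⟩ := h.1 c hc
      obtain ⟨w, hw⟩ := Finset.card_pos.1 (lt_of_lt_of_le (Nat.succ_pos _) h1)
      have h3 := h2 w (Finset.mem_filter.1 hw).2
      have h4 : ((matchedInto M κ n c : ℕ) : ℝ) + 1 ≤ (Finset.univ.filter fun x => κ x = c).card := by
        exact_mod_cast h1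
      -- The remaining slack is at most `θ`, exactly what is saved by the optimum missing a vertex
      -- of the tree.
      nlinarith [hφθ n w, mul_le_mul_of_nonneg_left h4 hθ]
    · have h3 := h.2 c hc
      have h4 : ((matchedInto M κ n c : ℕ) : ℝ) ≤ (Finset.univ.filter fun x => κ x = c).card := by
        exact_mod_cast hM.matchedInto_le κ n c
      nlinarith [mul_le_mul_of_nonneg_left h4 hθ]
  have hfin := Finset.sum_le_sum fun c (_ : c ∈ Finset.univ) => hbound c
  rw [← Finset.mul_sum, Finset.sum_sub_distrib, hcardm, Finset.sum_fiberwise] at hfin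
  rw [← hMopt, hsize]
  push_cast
  exact hfin

theorem sum_toReal_map_mul {α β : Type*} [Fintype α] [Fintype β] (P : PMF α) (f : α → β)
    (g : β → ℝ) : ∑ b, ((P.map f) b).toReal * g b = ∑ a, (P a).toReal * g (f a) := by
  classical
  have h : ∀ b, ((P.map f) b).toReal = ∑ a, if b = f a then (P a).toReal else 0 := fun b => by
    rw [PMF.map_apply, tsum_fintype, ENNReal.toReal_sum]
    · refine Finset.sum_congr rfl fun a _ => ?_
      split_ifs <;> simp
    · intro a _
      split_ifs
      · exact PMF.apply_ne_top _ _
      · simp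
  simp only [h, Finset.sum_mul]
  rw [Finset.sum_comm]
  refine Finset.sum_congr rfl fun a _ => ?_
  simp

/-! ### The series that defines the potential of Half-Half -/

/-- The terms of `∑ j ≥ 1, q ^ (2 ^ j) / 2 ^ j`. -/
noncomputable def rhoTerm (q : ℝ) (j : ℕ) : ℝ := q ^ 2 ^ j / 2 ^ j

theorem rhoTerm_nonneg {q : ℝ} (hq : 0 ≤ q) (j : ℕ) : 0 ≤ rhoTerm q j := by
  unfold rhoTerm; positivity

theorem summable_rhoTerm {q : ℝ} (hq : 0 ≤ q) (hq1 : q ≤ 1) : Summable (rhoTerm q) := by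
  refine Summable.of_nonneg_of_le (rhoTerm_nonneg hq) (fun j => ?_) summable_geometric_two
  rw [rhoTerm, one_div, inv_pow, ← one_div]
  gcongr
  exact pow_le_one₀ hq hq1

/-- The sum `∑ j ≥ 1, q ^ (2 ^ j) / 2 ^ j`. -/
noncomputable def rho (q : ℝ) : ℝ := ∑' j, rhoTerm q (j + 1)

theorem rho_nonneg {q : ℝ} (hq : 0 ≤ q) : 0 ≤ rho q :=
  tsum_nonneg fun _ => rhoTerm_nonneg hq _

/-- The summand `r` is the term with index 0 of the series, so the left side is the full series at
`r`. AM-GM bounds `(a * b) ^ 2 ^ j` by the mean of `a ^ 2 ^ (j + 1)` and `b ^ 2 ^ (j + 1)`, so its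
term `j` is bounded by the terms `j + 1` of the two series on the right. -/
theorem add_rho_le {a b r : ℝ} (ha : 0 ≤ a) (ha1 : a ≤ 1) (hb : 0 ≤ b) (hb1 : b ≤ 1) (hr : 0 ≤ r)
    (hrab : r ≤ a * b) : r + rho r ≤ rho a + rho b := by
  have hsr := summable_rhoTerm hr (hrab.trans (mul_le_one₀ ha1 hb hb1))
  have hsa := (summable_nat_add_iff 1).2 (summable_rhoTerm ha ha1)
  have hsb := (summable_nat_add_iff 1).2 (summable_rhoTerm hb hb1)
  have h0 : r + rho r = ∑' j, rhoTerm r j := by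
    rw [hsr.tsum_eq_zero_add, rho]
    simp [rhoTerm]
  rw [h0, rho, rho, ← hsa.tsum_add hsb]
  refine hsr.tsum_le_tsum (fun j => ?_) (hsa.add hsb)
  have h1 : r ^ 2 ^ j ≤ a ^ 2 ^ j * b ^ 2 ^ j := by
    rw [← mul_pow]
    exact pow_le_pow_left₀ hr hrab _
  unfold rhoTerm
  rw [pow_succ 2 j, pow_mul, pow_mul, pow_succ 2 j, ← add_div, div_le_div_iff₀ (by positivity)
    (by positivity)]
  nlinarith [sq_nonneg (a ^ 2 ^ j - b ^ 2 ^ j), pow_pos (zero_lt_two' ℝ) j]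

/-- This makes `φ 1` the maximum of `φ` on the unit interval. Factoring a difference of squares
shows that the termwise differences at `1 / 2` and `q` at least halve with every index, so from
index 1 on they add up to at most `1 / 2 - q`. -/
theorem sub_rho_le_half {q : ℝ} (hq : 0 ≤ q) (hq1 : q ≤ 1 / 2) :
    q - rho q ≤ 1 / 2 - rho (1 / 2) := by
  have hsx := (summable_nat_add_iff 1).2 (summable_rhoTerm (q := 1 / 2) (by norm_num) (by norm_num))
  have hsq := (summable_nat_add_iff 1).2 (summable_rhoTerm hq (hq1.trans (by norm_num)))
  have hd : ∀ j, rhoTerm (1 / 2) j - rhoTerm q j ≤ (1 / 2 - q) * (1 / 2) ^ j := by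
    intro j
    induction j with
    | zero => simp [rhoTerm]
    | succ j ih =>
      have hx : ((1 : ℝ) / 2) ^ 2 ^ j ≤ 1 / 2 := by
        refine (pow_le_of_le_one (by norm_num) (by norm_num) (by positivity)).trans le_rfl
      have hqx : q ^ 2 ^ j ≤ (1 / 2) ^ 2 ^ j := pow_le_pow_left₀ hq hq1 _
      have hq0 : 0 ≤ q ^ 2 ^ j := by positivity
      have hfac : rhoTerm (1 / 2) (j + 1) - rhoTerm q (j + 1) =
          (rhoTerm (1 / 2) j - rhoTerm q j) * (((1 / 2) ^ 2 ^ j + q ^ 2 ^ j) / 2) := by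
        unfold rhoTerm
        rw [pow_succ 2 j, pow_mul, pow_mul, pow_succ 2 j]
        field_simp
        ring
      have hnn : 0 ≤ rhoTerm (1 / 2) j - rhoTerm q j := by
        unfold rhoTerm
        rw [← sub_div]
        exact div_nonneg (by linarith) (by positivity)
      rw [hfac, pow_succ, ← mul_assoc]
      exact mul_le_mul ih (by linarith) (by linarith) (by
        have : 0 ≤ 1 / 2 - q := by linarith
        positivity)
  have : rho (1 / 2) - rho q ≤ 1 / 2 - q := by
    rw [rho, rho, ← hsx.tsum_sub hsq]
    have hg : HasSum (fun j : ℕ => (1 / 2 - q) * ((1 : ℝ) / 2) ^ (j + 1)) (1 / 2 - q) := by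
      have := (hasSum_geometric_two.mul_right (1 / 2 : ℝ)).mul_left (1 / 2 - q)
      simpa [pow_succ] using this
    exact hasSum_le (fun j => hd (j + 1)) (hsx.sub hsq).hasSum hg
  linarith

theorem eta_eq : eta = 1 - 2 * rho (1 / 2) := by
  rw [eta, rho, ← tsum_mul_left]
  congr 2
  ext i
  rw [rhoTerm, pow_add, one_div_pow, pow_succ (2 : ℝ) i]
  field_simp

/-! ### Free probabilities under Half-Half and their negative correlation -/

/-- Flipping the coin of one online vertex. -/
def flipCoin {ι : Type*} [DecidableEq ι] (j : ι) (coin : ι → Bool) : ι → Bool :=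
  Function.update coin j (!coin j)

theorem flipCoin_involutive {ι : Type*} [DecidableEq ι] (j : ι) :
    Function.Involutive (flipCoin j) := fun coin => by
  simp [flipCoin]

theorem sum_flipCoin {ι : Type*} [DecidableEq ι] [Fintype ι] (j : ι) (f : (ι → Bool) → ℝ) :
    ∑ coin, f (flipCoin j coin) = ∑ coin, f coin :=
  Equiv.sum_comp (flipCoin_involutive j).toPerm f

theorem halfHalfUsed_flipCoin {m n : ℕ} (G : Instance m n) (coin : Fin n → Bool) (j : Fin n)
    (t : ℕ) (ht : t ≤ j) :
    halfHalfUsed (flipCoin j coin) G t = halfHalfUsed coin G t := by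
  induction t with
  | zero => rfl
  | succ t ih =>
    have h := j.2
    have htn : t < n := by omega
    have hne : (⟨t, htn⟩ : Fin n) ≠ j := by
      intro e
      rw [← e] at ht
      simp at ht
    simp only [halfHalfUsed, htn, dite_true, ih (by omega)]
    simp only [flipCoin, Function.update_of_ne hne]

open Classical in
/-- The probability that all vertices of `S` are free after `t` arrivals. -/
noncomputable def freeProb {m n : ℕ} (G : Instance m n) (t : ℕ) (S : Finset (Fin m)) : ℝ :=
  (∑ coin : Fin n → Bool, if Disjoint S (halfHalfUsed coin G t) then 1 else 0) / 2 ^ n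

theorem freeProb_nonneg {m n : ℕ} (G : Instance m n) (t : ℕ) (S : Finset (Fin m)) :
    0 ≤ freeProb G t S := by
  unfold freeProb
  refine div_nonneg (Finset.sum_nonneg fun c _ => ?_) (by positivity)
  split_ifs <;> norm_num

theorem freeProb_zero {m n : ℕ} (G : Instance m n) (S : Finset (Fin m)) :
    freeProb G 0 S = 1 := by
  simp [freeProb, halfHalfUsed]

theorem freeProb_anti {m n : ℕ} (G : Instance m n) (t : ℕ) {S S' : Finset (Fin m)} (h : S ⊆ S') :
    freeProb G t S' ≤ freeProb G t S := by
  unfold freeProb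
  gcongr with c
  split_ifs with h1 h2
  · exact le_rfl
  · exact absurd (h1.mono_left h) h2
  · norm_num
  · norm_num

theorem freeProb_le_one {m n : ℕ} (G : Instance m n) (t : ℕ) (S : Finset (Fin m)) :
    freeProb G t S ≤ 1 := by
  refine (freeProb_anti G t (Finset.empty_subset S)).trans ?_
  simp [freeProb]

theorem halfHalfRun_mem {m n : ℕ} {coin : Fin n → Bool} {G : Instance m n} {j : Fin n} {i : Fin m}
    (h : halfHalfRun coin G j = some i) : i ∈ G.nbhd j :=
  (Finset.mem_sdiff.1 (halfHalfChoice_mem h)).1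

theorem halfHalfChoice_pair {m : ℕ} (u v : Fin m) (c : Bool) :
    halfHalfChoice c {u, v} = some u ∧ halfHalfChoice (!c) {u, v} = some v ∨
    halfHalfChoice c {u, v} = some v ∧ halfHalfChoice (!c) {u, v} = some u := by
  have hne : ({u, v} : Finset (Fin m)).Nonempty := ⟨u, by simp⟩
  have hmin : ({u, v} : Finset (Fin m)).min' hne = min u v := by
    simp [Finset.min'_insert u {v} (by simp)]
  have hmax : ({u, v} : Finset (Fin m)).max' hne = max u v := by
    simp [Finset.max'_insert u {v} (by simp)]
  unfold halfHalfChoice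
  simp only [hne, dite_true, hmin, hmax]
  rcases le_total u v with h | h <;> cases c <;> simp [h]

theorem disjoint_halfHalfUsed_succ {m n : ℕ} (G : Instance m n) (coin : Fin n → Bool) (j : Fin n)
    (S : Finset (Fin m)) : Disjoint S (halfHalfUsed coin G (j + 1)) ↔
      Disjoint S (halfHalfUsed coin G j) ∧ ∀ i ∈ S, halfHalfRun coin G j ≠ some i := by
  rw [halfHalfUsed_succ, Finset.disjoint_union_right]
  refine and_congr Iff.rfl ?_
  rw [Finset.disjoint_left]
  simp

theorem freeProb_succ_of_disjoint {m n : ℕ} (G : Instance m n) (j : Fin n) {S : Finset (Fin m)}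
    (h : Disjoint S (G.nbhd j)) : freeProb G (j + 1) S = freeProb G j S := by
  unfold freeProb
  congr 1
  refine Finset.sum_congr rfl fun coin _ => ?_
  congr 1
  rw [disjoint_halfHalfUsed_succ, eq_iff_iff, and_iff_left]
  exact fun i hi e => Finset.disjoint_left.1 h hi (halfHalfRun_mem e)

theorem freeProb_succ_of_subset {m n : ℕ} (G : Instance m n) (j : Fin n) {S : Finset (Fin m)}
    (hne : (G.nbhd j).Nonempty) (h : G.nbhd j ⊆ S) : freeProb G (j + 1) S = 0 := by
  unfold freeProb
  rw [div_eq_zero_iff]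
  left
  refine Finset.sum_eq_zero fun coin _ => if_neg ?_
  rw [disjoint_halfHalfUsed_succ]
  rintro ⟨h1, h2⟩
  have hsd : G.nbhd j \ halfHalfUsed coin G j = G.nbhd j :=
    Finset.sdiff_eq_self_of_disjoint (h1.mono_left h)
  have : halfHalfRun coin G j ≠ none := by
    simp [halfHalfRun, hsd, halfHalfChoice, hne]
  obtain ⟨i, hi⟩ := Option.ne_none_iff_exists'.1 this
  exact h2 i (h (halfHalfRun_mem hi)) hi

/-- Pair each coin sequence with the one flipped at `j`. If `S` and `v` are free, exactly one of the
two takes `u`. If `S` is free but `v` is not, both take `u`. -/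
theorem freeProb_succ_of_pair {m n : ℕ} (G : Instance m n) (j : Fin n) {S : Finset (Fin m)}
    {u v : Fin m} (hn : G.nbhd j = {u, v}) (hu : u ∈ S) (hv : v ∉ S) :
    freeProb G (j + 1) S = freeProb G j (insert v S) / 2 := by
  classical
  have huv : u ≠ v := fun e => hv (e ▸ hu)
  unfold freeProb
  rw [div_right_comm]
  congr 1
  rw [eq_div_iff two_ne_zero, mul_two]
  nth_rw 1 [← sum_flipCoin j]
  rw [← Finset.sum_add_distrib]
  refine Finset.sum_congr rfl fun coin _ => ?_
  simp only [disjoint_halfHalfUsed_succ, halfHalfUsed_flipCoin G coin j j le_rfl,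
    Finset.disjoint_insert_left]
  have hrun : ∀ c : Fin n → Bool, (∀ i ∈ S, halfHalfRun c G j ≠ some i) ↔
      halfHalfRun c G j ≠ some u := fun c => by
    refine ⟨fun h => h u hu, fun h i hi e => ?_⟩
    have := halfHalfRun_mem e
    rw [hn, Finset.mem_insert, Finset.mem_singleton] at this
    rcases this with rfl | rfl
    · exact h e
    · exact hv hi
  simp only [hrun]
  by_cases hS : Disjoint S (halfHalfUsed coin G j)
  · have hu' : u ∉ halfHalfUsed coin G j := Finset.disjoint_left.1 hS hu
    have hflip : halfHalfUsed (flipCoin j coin) G j = halfHalfUsed coin G j :=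
      halfHalfUsed_flipCoin G coin j j le_rfl
    by_cases hv' : v ∈ halfHalfUsed coin G j
    · have hsd : G.nbhd j \ halfHalfUsed coin G j = {u} := by
        rw [hn]
        ext x
        simp only [Finset.mem_sdiff, Finset.mem_insert, Finset.mem_singleton]
        constructor
        · rintro ⟨rfl | rfl, h⟩
          · rfl
          · exact absurd hv' h
        · rintro rfl
          exact ⟨Or.inl rfl, hu'⟩
      simp [halfHalfRun, hflip, hsd, hS, hv', halfHalfChoice]
    · have hsd : G.nbhd j \ halfHalfUsed coin G j = {u, v} := by
        rw [hn]
        refine Finset.sdiff_eq_self_of_disjoint ?_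
        simp [hu', hv']
      have hc : flipCoin j coin j = !coin j := by simp [flipCoin]
      simp only [halfHalfRun, hflip, hsd, hS, hv', hc]
      rcases halfHalfChoice_pair u v (coin j) with ⟨h1, h2⟩ | ⟨h1, h2⟩ <;>
        simp [h1, h2, huv.symm]
  · simp [hS]

/-- An arrival matters only if it meets `S ∪ T`. If its neighbourhood lies inside, the left side
becomes 0. Otherwise exactly one neighbour is inside, say in `S`; then adding the other neighbour to
`S` and halving expresses both sides by the previous time, and `T` is unaffected. This is why the
induction needs arbitrary sets. -/
theorem freeProb_union_le {m n : ℕ} (G : Instance m n) {t : ℕ} (ht : t ≤ n)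
    (S T : Finset (Fin m)) (hST : Disjoint S T) :
    freeProb G t (S ∪ T) ≤ freeProb G t S * freeProb G t T := by
  induction t generalizing S T with
  | zero => simp [freeProb_zero]
  | succ t ih =>
    have ih := fun S T hST => ih (by omega) S T hST
    obtain ⟨j, rfl⟩ : ∃ j : Fin n, (j : ℕ) = t := ⟨⟨t, ht⟩, rfl⟩
    have hnn := mul_nonneg (freeProb_nonneg G (j + 1) S) (freeProb_nonneg G (j + 1) T)
    by_cases hd : Disjoint (S ∪ T) (G.nbhd j)
    · rw [Finset.disjoint_union_left] at hd
      rw [freeProb_succ_of_disjoint G j hd.1, freeProb_succ_of_disjoint G j hd.2,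
        freeProb_succ_of_disjoint G j (Finset.disjoint_union_left.2 hd)]
      exact ih S T hST
    · obtain ⟨u, huST, hu⟩ := Finset.not_disjoint_iff.1 hd
      by_cases hsub : G.nbhd j ⊆ S ∪ T
      · rwa [freeProb_succ_of_subset G j ⟨u, hu⟩ hsub]
      · obtain ⟨v, hv, hvST⟩ := Finset.not_subset.1 hsub
        have huv : u ≠ v := fun e => hvST (e ▸ huST)
        have hn : G.nbhd j = {u, v} := G.nbhd_eq_pair hu hv huv
        rw [Finset.mem_union, not_or] at hvST
        have key : ∀ S T : Finset (Fin m), Disjoint S T → v ∉ S → v ∉ T → u ∈ S →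
            freeProb G (j + 1) (S ∪ T) ≤ freeProb G (j + 1) S * freeProb G (j + 1) T := by
          intro S T hST hvS hvT huS
          have huT : u ∉ T := Finset.disjoint_left.1 hST huS
          rw [freeProb_succ_of_pair G j hn (Finset.mem_union_left _ huS)
            (by simp [hvS, hvT]), freeProb_succ_of_pair G j hn huS hvS,
            freeProb_succ_of_disjoint G j (by simp [hn, huT, hvT]), ← Finset.insert_union]
          have := ih (insert v S) T (by simp [hST, hvT])
          linarith
        rcases Finset.mem_union.1 huST with h | h
        · exact key S T hST hvST.1 hvST.2 h
        · rw [Finset.union_comm, mul_comm]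
          exact key T S hST.symm hvST.2 hvST.1 h

theorem size_eq_card_used {m n : ℕ} (G : Instance m n) (coin : Fin n → Bool) :
    size (halfHalfRun coin G) = (halfHalfUsed coin G n).card := by
  have key : ∀ t ≤ n, (halfHalfUsed coin G t).card =
      (Finset.univ.filter fun j : Fin n => (j : ℕ) < t ∧ (halfHalfRun coin G j).isSome).card := by
    intro t
    induction t with
    | zero => simp [halfHalfUsed]
    | succ t ih =>
      intro ht
      have ih := ih (by omega)
      obtain ⟨j, rfl⟩ : ∃ j : Fin n, (j : ℕ) = t := ⟨⟨t, ht⟩, rfl⟩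
      have hdisj : Disjoint (halfHalfUsed coin G j) (halfHalfRun coin G j).toFinset := by
        rw [Finset.disjoint_right]
        intro i hi
        exact (Finset.mem_sdiff.1 (halfHalfChoice_mem (Option.mem_toFinset.1 hi))).2
      rw [halfHalfUsed_succ, Finset.card_union_of_disjoint hdisj, ih]
      cases hr : halfHalfRun coin G j with
      | none =>
        simp only [Option.toFinset_none, Finset.card_empty, add_zero]
        congr 1
        ext k
        simp only [Finset.mem_filter, Finset.mem_univ, true_and]
        refine ⟨fun h => ⟨by omega, h.2⟩, fun h => ⟨?_, h.2⟩⟩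
        have : k ≠ j := fun e => by simp [e, hr] at h
        rw [Ne, Fin.ext_iff] at this
        omega
      | some i =>
        rw [Option.toFinset_some, Finset.card_singleton, ← Finset.card_insert_of_notMem (a := j)
          (by simp)]
        congr 1
        ext k
        simp only [Finset.mem_insert, Finset.mem_filter, Finset.mem_univ, true_and]
        by_cases hk : k = j
        · subst hk; simp [hr]
        · have : (k : ℕ) ≠ j := fun e => hk (Fin.ext e)
          simp only [hk, false_or]
          refine and_congr_left fun _ => by omega
  rw [key n le_rfl, size]
  simp

theorem expectedSize_halfHalf {m n : ℕ} (G : Instance m n) :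
    (halfHalf m n).expectedSize G = m - ∑ x, freeProb G n {x} := by
  have h2 : ((2 : ℝ) ^ n) ≠ 0 := by positivity
  rw [RandAlgorithm.expectedSize, RandAlgorithm.output, halfHalf, PMF.map_comp,
    sum_toReal_map_mul]
  simp only [PMF.uniformOfFintype_apply, freeProb, Function.comp, halfHalfDet, size_eq_card_used]
  rw [← Finset.sum_div, Finset.sum_comm, ← Finset.mul_sum]
  have : ∀ coin : Fin n → Bool, (∑ x : Fin m, if Disjoint {x} (halfHalfUsed coin G n) then (1 : ℝ)
      else 0) = m - (halfHalfUsed coin G n).card := fun coin => by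
    rw [eq_sub_iff_add_eq]
    simp only [Finset.disjoint_singleton_left, Finset.sum_boole]
    rw [← Nat.cast_add, ← Finset.compl_filter, Finset.filter_mem_eq_inter, Finset.univ_inter,
      Finset.card_compl_add_card, Fintype.card_fin]
  simp only [this, Finset.sum_sub_distrib]
  simp
  field_simp
  ring

theorem isCompetitive_halfHalf : IsCompetitive eta halfHalf := by
  intro m n G
  rw [expectedSize_halfHalf]
  have hle1 := fun t (x : Fin m) => freeProb_le_one G t {x}
  have hnn := fun t (x : Fin m) => freeProb_nonneg G t {x}
  have hpu : ∀ (j : Fin n) (u v : Fin m), u ≠ v → G.nbhd j = {u, v} →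
      freeProb G (j + 1) {u} = freeProb G j {u, v} / 2 := fun j u v huv hn => by
    rw [freeProb_succ_of_pair G j hn (by simp) (by simp [huv.symm]), Finset.pair_comm]
  have hsum : ∀ (j : Fin n) (u v : Fin m), u ≠ v → G.nbhd j = {u, v} →
      ∑ x ∈ G.nbhd j, (freeProb G j {x} - freeProb G (j + 1) {x}) =
        freeProb G j {u} + freeProb G j {v} - freeProb G j {u, v} := fun j u v huv hn => by
    rw [hn, Finset.sum_pair huv, hpu j u v huv hn, hpu j v u huv.symm (by rw [hn, Finset.pair_comm]),
      Finset.pair_comm v u]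
    ring
  have hone : (1 : ℝ) - 2 * rho (1 / 2) = eta := eta_eq.symm
  -- With `r` the probability that `u` and `v` are both free, the drop is `p u + p v - r` and both
  -- ends become free with probability `r / 2`. The linear part of `φ` cancels against the drop, and
  -- `add_rho_le` at `p u / 2`, `p v / 2`, `r / 4` remains.
  refine mul_opt_le_of_potential G (φ := fun x => x - 2 * rho (x / 2))
    (p := fun t x => freeProb G t {x}) ?_ (fun x => freeProb_zero G _) hone hnn
    (fun x hx => ?_) (fun t x => ?_) (fun j x hx => ?_) (fun j u hu => ?_)
    (fun j u hu v hv huv => ?_)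
  · have := sub_rho_le_half (q := 0) le_rfl (by norm_num)
    have h0 : rho 0 = 0 := by simp [rho, rhoTerm]
    rw [← hone]
    linarith
  · linarith [rho_nonneg (q := x / 2) (by linarith)]
  · have := sub_rho_le_half (q := freeProb G t {x} / 2) (by linarith [hnn t x])
      (by linarith [hle1 t x])
    rw [← hone]
    linarith
  · exact freeProb_succ_of_disjoint G j (by simpa using hx)
  · rcases Instance.nbhd_eq_of_mem hu with hn | ⟨v, huv, hn⟩
    · rw [hn, Finset.sum_singleton, freeProb_succ_of_subset G j ⟨u, hu⟩ (by rw [hn]), sub_zero]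
    · rw [hsum j u v huv hn]
      linarith [freeProb_anti G j (S := {v}) (S' := {u, v}) (by simp)]
  · have hn := G.nbhd_eq_pair hu hv huv
    rw [hsum j u v huv hn, hpu j u v huv hn]
    have hneg := freeProb_union_le G j.2.le {u} {v} (by simpa using huv)
    rw [← Finset.insert_eq] at hneg
    have h3 := freeProb_nonneg G j {u, v}
    have := add_rho_le (a := freeProb G j {u} / 2) (b := freeProb G j {v} / 2)
      (r := freeProb G j {u, v} / 2 / 2) (by linarith [hnn j u]) (by linarith [hle1 j u])
      (by linarith [hnn j v]) (by linarith [hle1 j v]) (by linarith) (by linarith)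
    linarith

/-! ### Random tree instances -/

/-- The hard instances are binary trees in heap order: the leaves `N, …, 2 * N - 1` stand for the
offline vertices, and the inner node `0 < h < N` with children `2 * h` and `2 * h + 1` stands for an
online vertex.  A coin decides which of the vertices represented by the children of `h` stays active
and represents `h`. -/
def active {N : ℕ} [NeZero N] (ω : Fin N → Bool) (h : ℕ) : Fin N :=
  if hN : 0 < h ∧ h < N then
    if ω ⟨h, hN.2⟩ then active ω (2 * h) else active ω (2 * h + 1)
  else Fin.ofNat N h
termination_by 2 * N - h

/-- The vertex that is retired at the inner node `h`. -/
def retired {N : ℕ} [NeZero N] (ω : Fin N → Bool) (h : ℕ) : Fin N :=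
  if hN : h < N then
    if ω ⟨h, hN⟩ then active ω (2 * h + 1) else active ω (2 * h)
  else Fin.ofNat N h

section Tree

variable {N : ℕ} [NeZero N] (ω : Fin N → Bool)

theorem active_congr {ω ω' : Fin N → Bool} (h : ℕ) (H : ∀ i : Fin N, h ≤ i → ω i = ω' i) :
    active ω h = active ω' h := by
  rw [active.eq_def ω h, active.eq_def ω' h]
  split_ifs with hN h1 h2 h2
  · exact active_congr _ fun i hi => H i (by omega)
  · exact absurd (H ⟨h, hN.2⟩ le_rfl ▸ h1) h2
  · exact absurd ((H ⟨h, hN.2⟩ le_rfl).symm ▸ h2) h1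
  · exact active_congr _ fun i hi => H i (by omega)
  · rfl
termination_by 2 * N - h

theorem active_flipCoin_of_lt {h v : ℕ} (hN : h < N) (hv : h < v) :
    active (flipCoin ⟨h, hN⟩ ω) v = active ω v := by
  refine active_congr v fun i hi => ?_
  rw [flipCoin, Function.update_of_ne]
  rintro rfl
  simp only at hi
  omega

theorem active_retired {h : ℕ} (h0 : 0 < h) (hN : h < N) :
    active ω h = active ω (2 * h) ∧ retired ω h = active ω (2 * h + 1) ∨
    active ω h = active ω (2 * h + 1) ∧ retired ω h = active ω (2 * h) := by
  rw [active, retired]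
  simp only [h0, hN, and_self, dite_true]
  split_ifs <;> simp

theorem active_flipCoin {h : ℕ} (h0 : 0 < h) (hN : h < N) :
    active (flipCoin ⟨h, hN⟩ ω) h = retired ω h := by
  rw [active, retired]
  simp only [h0, hN, and_self, dite_true]
  rw [active_flipCoin_of_lt ω hN (by omega), active_flipCoin_of_lt ω hN (by omega)]
  cases hω : ω ⟨h, hN⟩ <;> simp [flipCoin, hω]

/-- Once the nodes from `h` upwards have arrived, `h, …, 2 * h - 1` are the roots of the current
forest. Passing from `h + 1` to `h` replaces the roots `2 * h` and `2 * h + 1` by `h`, which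
inherits the vertex of one of them. -/
theorem injOn_active {h : ℕ} (h0 : 0 < h) (hN : h ≤ N) :
    Set.InjOn (active ω) (Set.Ico h (2 * h)) := by
  induction hN using Nat.decreasingInduction with
  | self =>
    intro u hu v hv huv
    have hu' : ¬ (0 < u ∧ u < N) := fun h => absurd hu.1 (by omega)
    have hv' : ¬ (0 < v ∧ v < N) := fun h => absurd hv.1 (by omega)
    rw [active.eq_def ω u, active.eq_def ω v, dif_neg hu', dif_neg hv'] at huv
    have := congrArg Fin.val huv
    simp only [Fin.ofNat_eq_cast, Fin.val_natCast] at this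
    rw [Nat.mod_eq_sub_mod hu.1, Nat.mod_eq_sub_mod hv.1, Nat.mod_eq_of_lt, Nat.mod_eq_of_lt] at this
    · have h1 := hu.1
      have h2 := hv.1
      omega
    · have := hv.2; omega
    · have := hu.2; omega
  | of_succ h hN ih =>
    have ih := ih (by omega)
    have key : ∀ v, h < v → v < 2 * h → active ω h ≠ active ω v := by
      intro v hv1 hv2 e
      rcases active_retired ω h0 hN with ⟨h1, -⟩ | ⟨h1, -⟩
      · have := ih (show 2 * h ∈ _ from ⟨by omega, by omega⟩) ⟨by omega, by omega⟩ (h1 ▸ e)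
        omega
      · have := ih (show 2 * h + 1 ∈ _ from ⟨by omega, by omega⟩) ⟨by omega, by omega⟩ (h1 ▸ e)
        omega
    intro u hu v hv huv
    obtain ⟨hu1, hu2⟩ := hu
    obtain ⟨hv1, hv2⟩ := hv
    rcases hu1.eq_or_lt with rfl | hu1
    · rcases hv1.eq_or_lt with rfl | hv1
      · rfl
      · exact absurd huv (key v hv1 hv2)
    · rcases hv1.eq_or_lt with rfl | hv1
      · exact absurd huv.symm (key u hu1 hu2)
      · exact ih ⟨by omega, by omega⟩ ⟨by omega, by omega⟩ huv

theorem active_ne {h u v : ℕ} (hN : h ≤ N) (hu : h ≤ u) (hu' : u < 2 * h) (hv : h ≤ v)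
    (hv' : v < 2 * h) (huv : u ≠ v) : active ω u ≠ active ω v :=
  fun e => huv (injOn_active ω (by omega) hN ⟨hu, hu'⟩ ⟨hv, hv'⟩ e)

theorem image_active_subset {h h' : ℕ} (h0 : 0 < h) (hh : h ≤ h') (hN : h' ≤ N) :
    Set.image (active ω) (Set.Ico h (2 * h)) ⊆ Set.image (active ω) (Set.Ico h' (2 * h')) := by
  induction hh using Nat.decreasingInduction with
  | self => exact subset_rfl
  | of_succ h hh ih =>
    refine Set.Subset.trans ?_ (ih (by omega))
    rintro _ ⟨v, ⟨hv1, hv2⟩, rfl⟩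
    rcases hv1.eq_or_lt with rfl | hv1
    · rcases active_retired ω h0 (hh.trans_le hN) with ⟨h1, -⟩ | ⟨h1, -⟩
      · exact ⟨2 * h, ⟨by omega, by omega⟩, h1.symm⟩
      · exact ⟨2 * h + 1, ⟨by omega, by omega⟩, h1.symm⟩
    · exact ⟨v, ⟨by omega, by omega⟩, rfl⟩

theorem retired_mem {h : ℕ} (h0 : 0 < h) (hN : h < N) :
    retired ω h ∈ Set.image (active ω) (Set.Ico (h + 1) (2 * (h + 1))) := by
  rcases active_retired ω h0 hN with ⟨-, h1⟩ | ⟨-, h1⟩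
  · exact ⟨2 * h + 1, ⟨by omega, by omega⟩, h1.symm⟩
  · exact ⟨2 * h, ⟨by omega, by omega⟩, h1.symm⟩

theorem retired_notMem {h : ℕ} (h0 : 0 < h) (hN : h < N) :
    retired ω h ∉ Set.image (active ω) (Set.Ico h (2 * h)) := by
  rintro ⟨v, ⟨hv1, hv2⟩, hv⟩
  have hne : active ω (2 * h) ≠ active ω (2 * h + 1) :=
    active_ne ω (h := h + 1) hN (by omega) (by omega) (by omega) (by omega) (by omega)
  rcases hv1.eq_or_lt with rfl | hv1
  · rcases active_retired ω h0 hN with ⟨h1, h2⟩ | ⟨h1, h2⟩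
    · exact hne (by rw [← h1, ← h2, hv])
    · exact hne (by rw [← h1, ← h2, hv])
  · rcases active_retired ω h0 hN with ⟨-, h2⟩ | ⟨-, h2⟩
    · exact active_ne ω (h := h + 1) hN (by omega) (by omega) (by omega) (by omega)
        (show v ≠ 2 * h + 1 by omega) (hv.trans h2)
    · exact active_ne ω (h := h + 1) hN (by omega) (by omega) (by omega) (by omega)
        (show v ≠ 2 * h by omega) (hv.trans h2)

theorem retired_ne_of_lt {u v : ℕ} (u0 : 0 < u) (huv : u < v) (hv : v < N) :
    retired ω u ≠ retired ω v := fun e => by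
  refine retired_notMem ω (by omega) hv (e ▸ ?_)
  exact image_active_subset ω (by omega) huv hv.le (retired_mem ω u0 (by omega))

/-- The instance in which the inner nodes of the tree arrive in decreasing order. -/
def treeInstance : Instance N (N - 1) where
  nbhd j := {active ω (2 * (N - 1 - j)), active ω (2 * (N - 1 - j) + 1)}
  degree_le_two _ := Finset.card_le_two

/-- Match every online vertex to the neighbour that it retires. Retired vertices never become active
again, so no vertex is used twice. -/
theorem le_opt_treeInstance : N - 1 ≤ opt (treeInstance ω) := by
  have hM : IsMatching (treeInstance ω) fun j => some (retired ω (N - 1 - j)) := by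
    refine ⟨fun j i hi => ?_, fun j k i hj hk => ?_⟩
    · rw [← Option.some.inj hi]
      have := j.2
      rcases active_retired ω (h := N - 1 - j) (by omega) (by omega) with ⟨-, h⟩ | ⟨-, h⟩ <;>
        simp [treeInstance, h]
    · have e : retired ω (N - 1 - j) = retired ω (N - 1 - k) :=
        (Option.some.inj hj).trans (Option.some.inj hk).symm
      have hj := j.2
      have hk := k.2
      rcases lt_trichotomy (N - 1 - (j : ℕ)) (N - 1 - k) with h | h | h
      · exact absurd e (retired_ne_of_lt ω (by omega) h (by omega))
      · exact Fin.ext (by omega)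
      · exact absurd e.symm (retired_ne_of_lt ω (by omega) h (by omega))
  refine le_trans ?_ hM.size_le_opt
  simp [size]

end Tree

/-! ### Online algorithms against the random tree -/

/-- The answers of an online algorithm on the tree instances, indexed by the inner nodes. -/
structure TreeStrategy {N : ℕ} [NeZero N] (r : (Fin N → Bool) → ℕ → Option (Fin N)) : Prop where
  mem : ∀ ω h i, r ω h = some i → i = active ω (2 * h) ∨ i = active ω (2 * h + 1)
  inj : ∀ ω h h' i, r ω h = some i → r ω h' = some i → h = h'
  flip : ∀ ω (h : ℕ) (hN : h < N) h', h ≤ h' → r (flipCoin ⟨h, hN⟩ ω) h' = r ω h'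
  eq_none : ∀ ω h, N ≤ h → r ω h = none

/-- The vertex that represents `v` has not been matched at any of the nodes `h, h + 1, …`. -/
def FreeAt {N : ℕ} [NeZero N] (r : (Fin N → Bool) → ℕ → Option (Fin N)) (ω : Fin N → Bool)
    (h v : ℕ) : Prop :=
  ∀ h', h ≤ h' → r ω h' ≠ some (active ω v)

namespace TreeStrategy

variable {N : ℕ} [NeZero N] {r : (Fin N → Bool) → ℕ → Option (Fin N)}

theorem freeAt_succ (hr : TreeStrategy r)
    {ω : Fin N → Bool} {h v : ℕ} (hN : h < N) (hv : h < v) (hv' : v < 2 * h) :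
    FreeAt r ω h v ↔ FreeAt r ω (h + 1) v := by
  refine ⟨fun H h' hh => H h' (by omega), fun H h' hh e => ?_⟩
  rcases hh.eq_or_lt with rfl | hh
  · rcases hr.mem _ _ _ e with h1 | h1
    · exact active_ne ω (h := h + 1) hN (by omega) (by omega) (by omega) (by omega)
        (show v ≠ 2 * h by omega) h1
    · exact active_ne ω (h := h + 1) hN (by omega) (by omega) (by omega) (by omega)
        (show v ≠ 2 * h + 1 by omega) h1
  · exact H h' hh e

/-- As long as `v` is a root, no arriving node touches its vertex, so freeness can be tested when
`v` itself arrives. -/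
theorem freeAt_self (hr : TreeStrategy r)
    {ω : Fin N → Bool} {h v : ℕ} (hN : h ≤ N) (hv : h ≤ v) (hv' : v < 2 * h) :
    FreeAt r ω h v ↔ FreeAt r ω v v := by
  induction hN using Nat.decreasingInduction with
  | self =>
    simp only [FreeAt]
    constructor
    · exact fun H h' hh => H h' (by omega)
    · intro _ h' hh
      simp [hr.eq_none ω h' hh]
  | of_succ h hN ih =>
    rcases hv.eq_or_lt with rfl | hv
    · rfl
    · rw [hr.freeAt_succ hN hv hv', ih (by omega) (by omega)]

theorem freeAt_flipCoin (hr : TreeStrategy r)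
    {ω : Fin N → Bool} {h v : ℕ} (hN : h < N) (hv : h < v) :
    FreeAt r (flipCoin ⟨h, hN⟩ ω) (h + 1) v ↔ FreeAt r ω (h + 1) v := by
  simp only [FreeAt]
  refine forall₂_congr fun h' hh => ?_
  rw [hr.flip ω h hN h' (by omega), active_flipCoin_of_lt ω hN hv]

open Classical in
/-- Joint freeness is at least as likely as if the coins were flipped by the algorithm. -/
theorem prod_le_sum_freeAt (hr : TreeStrategy r)
    {f : ℕ → ℝ} (hf : ∀ h, 0 ≤ f h) (hfN : ∀ h, N ≤ h → f h ≤ 1)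
    (hf2 : ∀ h, 0 < h → h < N → f h ≤ f (2 * h) * f (2 * h + 1) / 2)
    {h : ℕ} (h0 : 0 < h) (hN : h ≤ N) (S : Finset ℕ) (hS : S ⊆ Finset.Ico h (2 * h)) :
    2 ^ N * ∏ v ∈ S, f v ≤ ∑ ω : Fin N → Bool, if ∀ v ∈ S, FreeAt r ω h v then (1 : ℝ) else 0 := by
  induction hN using Nat.decreasingInduction generalizing S with
  | self =>
    have : ∀ ω : Fin N → Bool, ∀ v ∈ S, FreeAt r ω N v := fun ω v _ h' hh => by
      simp [hr.eq_none ω h' hh]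
    rw [Finset.sum_congr rfl fun ω _ => if_pos (this ω)]
    simp only [Finset.sum_const, Finset.card_univ, Fintype.card_fun, Fintype.card_bool,
      Fintype.card_fin, nsmul_eq_mul]
    push_cast
    refine mul_le_mul_of_nonneg_left (Finset.prod_le_one (fun v _ => hf v) fun v hv => ?_)
      (by positivity)
    exact hfN v (Finset.mem_Ico.1 (hS hv)).1
  | of_succ h hN ih =>
    have ih := ih (by omega)
    by_cases hhS : h ∈ S
    · set S' := S.erase h with hS'
      have hS_mem : ∀ v ∈ S', h < v ∧ v < 2 * h := fun v hv => by
        obtain ⟨h1, h2⟩ := Finset.mem_erase.1 hv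
        have := Finset.mem_Ico.1 (hS h2)
        omega
      have hn1 : 2 * h + 1 ∉ S' := fun hv => by have := hS_mem _ hv; omega
      have hn2 : 2 * h ∉ insert (2 * h + 1) S' := fun hv => by
        rcases Finset.mem_insert.1 hv with hv | hv
        · omega
        · have := hS_mem _ hv; omega
      have key := ih (insert (2 * h) (insert (2 * h + 1) S')) (by
        intro v hv
        simp only [Finset.mem_insert] at hv
        rw [Finset.mem_Ico]
        rcases hv with rfl | rfl | hv
        · omega
        · omega
        · have := hS_mem v hv; omega)
      rw [Finset.prod_insert hn2, Finset.prod_insert hn1] at key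
      have hprod : ∏ v ∈ S, f v ≤ (f (2 * h) * (f (2 * h + 1) * ∏ v ∈ S', f v)) / 2 := by
        rw [← Finset.mul_prod_erase S f hhS]
        have := mul_le_mul_of_nonneg_right (hf2 h h0 hN) (Finset.prod_nonneg fun v (_ : v ∈ S') => hf v)
        calc _ ≤ _ := this
          _ = _ := by ring
      -- The answer at `h` precedes its coin. If both children's vertices are free, at most one gets
      -- matched, so for at least one value of the coin the surviving vertex is free. This is where
      -- the factor 1/2 comes from.
      have hsum : (∑ ω : Fin N → Bool, if ∀ v ∈ insert (2 * h) (insert (2 * h + 1) S'),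
            FreeAt r ω (h + 1) v then (1 : ℝ) else 0) ≤
          2 * ∑ ω : Fin N → Bool, if ∀ v ∈ S, FreeAt r ω h v then (1 : ℝ) else 0 := by
        rw [two_mul (_ : ℝ)]
        nth_rw 3 [← sum_flipCoin ⟨h, hN⟩]
        rw [← Finset.sum_add_distrib]
        refine Finset.sum_le_sum fun ω _ => ?_
        split_ifs with h1 h2 h3 h3 <;> try norm_num
        have hfree : ∀ v ∈ insert (2 * h) (insert (2 * h + 1) S'), FreeAt r ω (h + 1) v := h1
        have hkey : ∀ ω', (∀ v ∈ S', FreeAt r ω' (h + 1) v) → FreeAt r ω' (h + 1) h →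
            (¬ ∀ v ∈ S, FreeAt r ω' h v) → r ω' h = some (active ω' h) := by
          intro ω' hs hh hn
          by_contra hne
          refine hn fun v hv => ?_
          by_cases hvh : v = h
          · subst hvh
            intro h' hh'
            rcases hh'.eq_or_lt with rfl | hh'
            · exact hne
            · exact hh h' hh'
          · have hv' : v ∈ S' := Finset.mem_erase.2 ⟨hvh, hv⟩
            have := hS_mem v hv'
            exact (hr.freeAt_succ hN this.1 this.2).2 (hs v hv')
        have f1 := hfree (2 * h) (by simp)
        have f2 := hfree (2 * h + 1) (by simp)
        have e1 := hkey ω (fun v hv => hfree v (by simp [hv])) (by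
          rcases active_retired ω h0 hN with ⟨e, -⟩ | ⟨e, -⟩
          · simpa only [FreeAt, e] using f1
          · simpa only [FreeAt, e] using f2) h2
        have e2 := hkey (flipCoin ⟨h, hN⟩ ω) (fun v hv =>
          (hr.freeAt_flipCoin hN (hS_mem v hv).1).2 (hfree v (by simp [hv]))) (by
          intro h' hh'
          rw [hr.flip ω h hN h' (by omega), active_flipCoin ω h0 hN]
          rcases active_retired ω h0 hN with ⟨-, e⟩ | ⟨-, e⟩
          · rw [e]; exact f2 h' hh'
          · rw [e]; exact f1 h' hh') h3
        rw [hr.flip ω h hN h le_rfl, active_flipCoin ω h0 hN, e1] at e2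
        refine retired_notMem ω h0 hN ⟨h, ⟨le_rfl, by omega⟩, Option.some.inj e2⟩
      nlinarith [mul_le_mul_of_nonneg_left hprod (pow_nonneg (zero_le_two (α := ℝ)) N)]
    · have hmem : ∀ v ∈ S, h < v ∧ v < 2 * h := fun v hv => by
        have h1 := Finset.mem_Ico.1 (hS hv)
        have : v ≠ h := fun e => hhS (e ▸ hv)
        omega
      have hiff : ∀ ω : Fin N → Bool, (∀ v ∈ S, FreeAt r ω h v) ↔ ∀ v ∈ S, FreeAt r ω (h + 1) v :=
        fun ω => forall₂_congr fun v hv => hr.freeAt_succ hN (hmem v hv).1 (hmem v hv).2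
      simp only [hiff]
      refine ih S fun v hv => ?_
      have := hmem v hv
      rw [Finset.mem_Ico]
      omega

-- Whether a match happens at `h` is the number of free neighbours before minus the number after.
-- Flipping the coin at `h` swaps the active and the retired vertex, so after summation both are
-- free equally often, hence the factor 2.
open Classical in
theorem sum_isSome_eq (hr : TreeStrategy r) {h : ℕ} (h0 : 0 < h) (hN : h < N) :
    (∑ ω, if (r ω h).isSome then (1 : ℝ) else 0) =
      (∑ ω, if FreeAt r ω (2 * h) (2 * h) then (1 : ℝ) else 0) +
      (∑ ω, if FreeAt r ω (2 * h + 1) (2 * h + 1) then (1 : ℝ) else 0) -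
      2 * ∑ ω, if FreeAt r ω h h then (1 : ℝ) else 0 := by
  rw [two_mul (_ : ℝ)]
  nth_rw 4 [← sum_flipCoin ⟨h, hN⟩]
  rw [← Finset.sum_add_distrib, ← Finset.sum_add_distrib, ← Finset.sum_sub_distrib]
  refine Finset.sum_congr rfl fun ω _ => ?_
  have s1 := hr.freeAt_self (ω := ω) (h := h + 1) (v := 2 * h) hN (by omega) (by omega)
  have s2 := hr.freeAt_self (ω := ω) (h := h + 1) (v := 2 * h + 1) hN (by omega) (by omega)
  rw [← s1, ← s2]
  obtain ⟨U, hU⟩ : ∃ U : Fin N → Prop, ∀ x, U x ↔ ∀ h', h + 1 ≤ h' → r ω h' ≠ some x :=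
    ⟨_, fun _ => Iff.rfl⟩
  have hsplit : ∀ x : Fin N, (∀ h', h ≤ h' → r ω h' ≠ some x) ↔ r ω h ≠ some x ∧ U x := fun x => by
    rw [hU]
    refine ⟨fun H => ⟨H h le_rfl, fun h' hh => H h' (by omega)⟩, fun H h' hh => ?_⟩
    rcases hh.eq_or_lt with rfl | hh
    · exact H.1
    · exact H.2 h' hh
  have t1 : FreeAt r (flipCoin ⟨h, hN⟩ ω) h h ↔
      r ω h ≠ some (retired ω h) ∧ U (retired ω h) := by
    rw [← hsplit]
    simp only [FreeAt, active_flipCoin ω h0 hN]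
    exact forall₂_congr fun h' hh => by rw [hr.flip ω h hN h' hh]
  have t2 : FreeAt r ω h h ↔ r ω h ≠ some (active ω h) ∧ U (active ω h) := hsplit _
  have t3 : ∀ v, FreeAt r ω (h + 1) v ↔ U (active ω v) := fun v => (hU _).symm
  have hne : active ω (2 * h) ≠ active ω (2 * h + 1) :=
    active_ne ω (h := h + 1) hN (by omega) (by omega) (by omega) (by omega) (by omega)
  have hused : ∀ x, r ω h = some x → U x := fun x hx => (hU x).2 fun h' hh e => by
    have := hr.inj ω h h' x hx e
    omega
  simp only [t1, t2, t3]
  have hmem := hr.mem ω h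
  cases hrh : r ω h with
  | none =>
    rcases active_retired ω h0 hN with ⟨e1, e2⟩ | ⟨e1, e2⟩
    · simp [e1, e2]
      ring
    · simp [e1, e2]
  | some x =>
    have hx := hused x hrh
    rcases hmem x hrh with rfl | rfl <;>
      rcases active_retired ω h0 hN with ⟨e1, e2⟩ | ⟨e1, e2⟩ <;>
      simp [e1, e2, hne, hne.symm, hx]

open Classical in
theorem sum_sum_isSome_le (hr : TreeStrategy r)
    {f : ℕ → ℝ} (hf : ∀ h, 0 ≤ f h) (hfN : ∀ h, N ≤ h → f h ≤ 1)
    (hf2 : ∀ h, 0 < h → h < N → f h ≤ f (2 * h) * f (2 * h + 1) / 2) :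
    ∑ h ∈ Finset.Ico 1 N, (∑ ω, if (r ω h).isSome then (1 : ℝ) else 0) ≤
      2 ^ N * (N - ∑ h ∈ Finset.Ico 1 N, f h) := by
  set x : ℕ → ℝ := fun v => ∑ ω, if FreeAt r ω v v then (1 : ℝ) else 0 with hx
  have hlow : ∀ h ∈ Finset.Ico 1 N, 2 ^ N * f h ≤ x h := fun h hh => by
    rw [Finset.mem_Ico] at hh
    simpa [hx] using hr.prod_le_sum_freeAt hf hfN hf2 (h := h) hh.1 hh.2.le {h}
      (by simp; omega)
  have hx0 : ∀ v, 0 ≤ x v := fun v => Finset.sum_nonneg fun ω _ => by split_ifs <;> norm_num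
  have hleaf : ∀ v ∈ Finset.Ico N (2 * N), x v = 2 ^ N := fun v hv => by
    have : ∀ ω, FreeAt r ω v v := fun ω h' hh => by
      simp [hr.eq_none ω h' ((Finset.mem_Ico.1 hv).1.trans hh)]
    simp [hx, this]
  have htel : ∀ K, 1 ≤ K → ∑ h ∈ Finset.Ico 1 K, (x (2 * h) + x (2 * h + 1)) =
      ∑ v ∈ Finset.Ico 2 (2 * K), x v := by
    intro K hK
    induction K, hK using Nat.le_induction with
    | base => simp
    | succ K hK ih =>
      rw [Finset.sum_Ico_succ_top hK, ih, mul_add, mul_one, Finset.sum_Ico_succ_top (by omega),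
        Finset.sum_Ico_succ_top (by omega)]
      ring
  have hN1 : 1 ≤ N := Nat.one_le_iff_ne_zero.2 (NeZero.ne N)
  -- Every node except the root is a child, so the sum telescopes to leaves minus inner nodes minus
  -- the root.
  have h1 : ∑ v ∈ Finset.Ico 2 (2 * N), x v + x 1 =
      ∑ h ∈ Finset.Ico 1 N, x h + ∑ v ∈ Finset.Ico N (2 * N), x v := by
    rw [Finset.sum_Ico_consecutive _ hN1 (by omega), add_comm,
      Finset.sum_eq_sum_Ico_succ_bot (a := 1) (by omega)]
  have h2 : ∑ v ∈ Finset.Ico N (2 * N), x v = 2 ^ N * N := by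
    rw [Finset.sum_congr rfl hleaf, Finset.sum_const, Nat.card_Ico, nsmul_eq_mul]
    rw [show 2 * N - N = N by omega]
    ring
  have h3 : ∑ h ∈ Finset.Ico 1 N, (∑ ω, if (r ω h).isSome then (1 : ℝ) else 0) =
      ∑ h ∈ Finset.Ico 1 N, (x (2 * h) + x (2 * h + 1)) - 2 * ∑ h ∈ Finset.Ico 1 N, x h := by
    rw [Finset.mul_sum, ← Finset.sum_sub_distrib]
    refine Finset.sum_congr rfl fun h hh => ?_
    rw [Finset.mem_Ico] at hh
    exact hr.sum_isSome_eq hh.1 hh.2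
  have h4 : 2 ^ N * ∑ h ∈ Finset.Ico 1 N, f h ≤ ∑ h ∈ Finset.Ico 1 N, x h := by
    rw [Finset.mul_sum]
    exact Finset.sum_le_sum hlow
  rw [h3, htel N hN1, mul_sub]
  linarith [hx0 1]

end TreeStrategy

/-- The answers of `D` on the tree instances. -/
def DetAlgorithm.treeRun {N : ℕ} [NeZero N] (D : DetAlgorithm N (N - 1)) (ω : Fin N → Bool)
    (h : ℕ) : Option (Fin N) :=
  if hN : 0 < h ∧ h < N then D.run (treeInstance ω) ⟨N - 1 - h, by omega⟩ else none

theorem DetAlgorithm.treeStrategy {N : ℕ} [NeZero N] (D : DetAlgorithm N (N - 1)) :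
    TreeStrategy D.treeRun where
  mem ω h i hi := by
    unfold treeRun at hi
    split_ifs at hi with hN
    have := (D.isMatching (treeInstance ω)).1 _ i hi
    rw [treeInstance] at this
    simp only [Finset.mem_insert, Finset.mem_singleton] at this
    rwa [show N - 1 - (N - 1 - h) = h by omega] at this
  inj ω h h' i hi hi' := by
    unfold treeRun at hi hi'
    split_ifs at hi hi' with h1 h2
    have := (D.isMatching (treeInstance ω)).2 _ _ i hi hi'
    rw [Fin.ext_iff] at this
    simp only at this
    omega
  flip ω h hN h' hh := by
    unfold treeRun
    split_ifs with h1
    · refine D.online _ _ _ fun k hk => ?_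
      rw [Fin.le_def] at hk
      simp only at hk
      have := k.2
      simp only [treeInstance]
      rw [active_flipCoin_of_lt ω hN (by omega), active_flipCoin_of_lt ω hN (by omega)]
    · rfl
  eq_none ω h hN := by
    unfold treeRun
    rw [dif_neg (by omega)]

theorem DetAlgorithm.sum_treeRun {N : ℕ} [NeZero N] (D : DetAlgorithm N (N - 1))
    (ω : Fin N → Bool) : (size (D.run (treeInstance ω)) : ℝ) =
      ∑ h ∈ Finset.Ico 1 N, if (D.treeRun ω h).isSome then (1 : ℝ) else 0 := by
  rw [size, Finset.card_filter]
  push_cast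
  symm
  refine Finset.sum_bij' (fun h hh => (⟨N - 1 - h, by rw [Finset.mem_Ico] at hh; omega⟩ : Fin (N - 1)))
    (fun j _ => N - 1 - j) (by simp) (fun j _ => ?_) (fun h hh => ?_) (fun j _ => ?_)
    (fun h hh => ?_)
  · have := j.2
    rw [Finset.mem_Ico]
    omega
  · rw [Finset.mem_Ico] at hh
    simp only
    omega
  · have := j.2
    ext
    simp only
    omega
  · rw [Finset.mem_Ico] at hh
    rw [treeRun, dif_pos (by omega)]

instance instFiniteInstance (m n : ℕ) : Finite (Instance m n) :=
  Finite.of_injective Instance.nbhd fun _ _ h => Instance.ext h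

instance instFiniteDetAlgorithm (m n : ℕ) : Finite (DetAlgorithm m n) :=
  Finite.of_injective DetAlgorithm.run fun _ _ h => DetAlgorithm.ext h

theorem sum_expectedSize_treeInstance_le {N : ℕ} [NeZero N] (A : RandAlgorithm N (N - 1))
    {f : ℕ → ℝ} (hf : ∀ h, 0 ≤ f h) (hfN : ∀ h, N ≤ h → f h ≤ 1)
    (hf2 : ∀ h, 0 < h → h < N → f h ≤ f (2 * h) * f (2 * h + 1) / 2) :
    ∑ ω, A.expectedSize (treeInstance ω) ≤ 2 ^ N * (N - ∑ h ∈ Finset.Ico 1 N, f h) := by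
  have := Fintype.ofFinite (DetAlgorithm N (N - 1))
  have hA : ∀ ω, A.expectedSize (treeInstance ω) =
      ∑ D, (A D).toReal * (size (D.run (treeInstance ω)) : ℝ) := fun ω =>
    sum_toReal_map_mul A (fun D => D.run (treeInstance ω)) fun M => (size M : ℝ)
  have hone : ∑ D, (A D).toReal = 1 := by
    have h := A.tsum_coe
    rw [tsum_fintype] at h
    rw [← ENNReal.toReal_sum fun D _ => A.apply_ne_top D, h, ENNReal.toReal_one]
  simp only [hA]
  rw [Finset.sum_comm, ← one_mul (2 ^ N * (N - ∑ h ∈ Finset.Ico 1 N, f h)), ← hone,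
    Finset.sum_mul]
  refine Finset.sum_le_sum fun D _ => ?_
  rw [← Finset.mul_sum]
  refine mul_le_mul_of_nonneg_left ?_ ENNReal.toReal_nonneg
  simp only [D.sum_treeRun]
  rw [Finset.sum_comm]
  exact D.treeStrategy.sum_sum_isSome_le hf hfN hf2

/-! ### Perfect trees and the value of `η` -/

theorem sum_Ico_two_pow_log (g : ℕ → ℝ) (k : ℕ) :
    ∑ h ∈ Finset.Ico 1 (2 ^ k), g (Nat.log 2 h) = ∑ l ∈ Finset.range k, 2 ^ l * g l := by
  induction k with
  | zero => simp
  | succ k ih =>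
    rw [Finset.sum_range_succ, ← ih, ← Finset.sum_Ico_consecutive _ Nat.one_le_two_pow
      (Nat.pow_le_pow_right two_pos k.le_succ)]
    congr 1
    rw [Finset.sum_congr rfl (g := fun _ => g k) fun h hh => ?_]
    · rw [Finset.sum_const, Nat.card_Ico, pow_succ, nsmul_eq_mul,
        show 2 ^ k * 2 - 2 ^ k = 2 ^ k by omega]
      push_cast
      rfl
    · rw [Finset.mem_Ico] at hh
      rw [Nat.log_eq_of_pow_le_of_lt_pow hh.1 hh.2]

theorem competitive_ratio_le {c : ℝ} (hc : 0 ≤ c) {A : ∀ m n : ℕ, RandAlgorithm m n}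
    (hA : IsCompetitive c A) (k : ℕ) :
    c * (1 - (1 / 2) ^ k) ≤ 1 - ∑ i ∈ Finset.range k, 1 / (2 : ℝ) ^ (2 ^ (i + 1) + i) := by
  -- A node of height `d` gets `2 ^ (-(2 ^ d - 1))`, the solution with equality of the recursion `f
  -- h = f (2 * h) * f (2 * h + 1) / 2`. Truncated subtraction gives height 0 and value 1 from the
  -- leaves on.
  set f : ℕ → ℝ := fun h => (1 / 2) ^ (2 ^ (k - Nat.log 2 h) - 1) with hf
  have hsum : ∑ h ∈ Finset.Ico 1 (2 ^ k), f h =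
      2 ^ k * ∑ i ∈ Finset.range k, 1 / (2 : ℝ) ^ (2 ^ (i + 1) + i) := by
    rw [hf, sum_Ico_two_pow_log (fun l => (1 / 2) ^ (2 ^ (k - l) - 1)) k,
      ← Finset.sum_range_reflect, Finset.mul_sum]
    refine Finset.sum_congr rfl fun i hi => ?_
    rw [Finset.mem_range] at hi
    rw [show k - (k - 1 - i) = i + 1 by omega, one_div_pow, mul_one_div, mul_one_div,
      div_eq_div_iff (by positivity) (by positivity), ← pow_add, ← pow_add]
    congr 1
    have := Nat.one_le_two_pow (n := i + 1)
    omega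
  have hlog : ∀ h, 0 < h → h < 2 ^ k → f h ≤ f (2 * h) * f (2 * h + 1) / 2 := by
    intro h h0 hk
    have h1 : Nat.log 2 (2 * h) = Nat.log 2 h + 1 := by
      rw [mul_comm, Nat.log_mul_base one_lt_two h0.ne']
    have h2 : Nat.log 2 (2 * h + 1) = Nat.log 2 h + 1 := by
      rw [Nat.log_of_one_lt_of_le one_lt_two (by omega)]
      congr 2
      omega
    have hlt : Nat.log 2 h < k := Nat.log_lt_of_lt_pow h0.ne' hk
    obtain ⟨d, hd⟩ : ∃ d, k - Nat.log 2 h = d + 1 := ⟨k - Nat.log 2 h - 1, by omega⟩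
    have hd' : k - (Nat.log 2 h + 1) = d := by omega
    simp only [hf, h1, h2, hd, hd']
    obtain ⟨e, he⟩ : ∃ e, 2 ^ d = e + 1 := ⟨2 ^ d - 1, by have := Nat.one_le_two_pow (n := d); omega⟩
    rw [pow_succ 2 d, he, show (e + 1) * 2 - 1 = e + e + 1 by omega, show e + 1 - 1 = e by omega,
      pow_succ, pow_add]
    apply le_of_eq
    ring
  have main := sum_expectedSize_treeInstance_le (N := 2 ^ k) (A _ _) (f := f)
    (fun h => by positivity) (fun h _ => pow_le_one₀ (by norm_num) (by norm_num)) hlog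
  have low : (2 : ℝ) ^ 2 ^ k * (c * (2 ^ k - 1)) ≤
      ∑ ω, (A (2 ^ k) (2 ^ k - 1)).expectedSize (treeInstance ω) := by
    have : ∀ ω ∈ (Finset.univ : Finset (Fin (2 ^ k) → Bool)), c * (2 ^ k - 1) ≤
        (A (2 ^ k) (2 ^ k - 1)).expectedSize (treeInstance ω) := fun ω _ => by
      refine le_trans ?_ (hA _ _ (treeInstance ω))
      refine mul_le_mul_of_nonneg_left ?_ hc
      have h1 : ((2 ^ k - 1 : ℕ) : ℝ) ≤ opt (treeInstance ω) := by
        exact_mod_cast le_opt_treeInstance ω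
      rwa [Nat.cast_sub Nat.one_le_two_pow, Nat.cast_pow, Nat.cast_one, Nat.cast_ofNat] at h1
    have := Finset.card_nsmul_le_sum _ _ _ this
    simpa [Finset.card_univ, nsmul_eq_mul] using this
  rw [hsum] at main
  have h2 := le_of_mul_le_mul_left (low.trans main) (by positivity)
  push_cast at h2
  have hk : (0 : ℝ) < 2 ^ k := by positivity
  refine le_of_mul_le_mul_left ?_ hk
  rw [one_div_pow]
  calc 2 ^ k * (c * (1 - 1 / 2 ^ k)) = c * (2 ^ k - 1) := by field_simp
    _ ≤ _ := h2
    _ = _ := by ring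

theorem summable_eta : Summable fun i : ℕ => 1 / (2 : ℝ) ^ (2 ^ (i + 1) + i) := by
  refine Summable.of_nonneg_of_le (fun i => by positivity) (fun i => ?_) summable_geometric_two
  rw [one_div_pow]
  gcongr
  · norm_num
  · exact Nat.le_add_left _ _

theorem abs_eta_sub_lt : |eta - 0.717772| < 0.0000005 := by
  have hs := summable_eta
  have h := hs.sum_add_tsum_nat_add 4
  have hpos : 0 ≤ ∑' i : ℕ, 1 / (2 : ℝ) ^ (2 ^ (i + 4 + 1) + (i + 4)) :=
    tsum_nonneg fun i => by positivity
  -- After four terms the exponents are at least `32 + i`, so a geometric series bounds the tail.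
  have htail : ∑' i : ℕ, 1 / (2 : ℝ) ^ (2 ^ (i + 4 + 1) + (i + 4)) ≤ (1 / 2 ^ 32) * 2 := by
    refine hasSum_le (fun i => ?_) ((summable_nat_add_iff 4).2 hs).hasSum
      (hasSum_geometric_two.mul_left _)
    rw [one_div_pow, one_div_mul_one_div, ← pow_add]
    have : 2 ^ 5 ≤ 2 ^ (i + 4 + 1) := Nat.pow_le_pow_right two_pos (by omega)
    exact one_div_le_one_div_of_le (by positivity) (pow_le_pow_right₀ one_le_two (by omega))
  rw [eta, ← h, abs_lt]
  norm_num [Finset.sum_range_succ] at hpos htail ⊢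
  constructor <;> linarith

theorem not_isCompetitive_of_eta_lt {c : ℝ} (hc : eta < c) (A : ∀ m n : ℕ, RandAlgorithm m n) :
    ¬ IsCompetitive c A := by
  intro hA
  have hc0 : 0 ≤ c := by
    have := (abs_lt.1 abs_eta_sub_lt).1
    norm_num at this
    linarith
  refine hc.not_ge ?_
  have h1 : Filter.Tendsto (fun k : ℕ => c * (1 - (1 / 2 : ℝ) ^ k)) Filter.atTop (nhds c) := by
    have := ((tendsto_pow_atTop_nhds_zero_of_lt_one (r := (1 / 2 : ℝ)) (by norm_num)
      (by norm_num)).const_sub 1).const_mul c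
    simpa using this
  exact le_of_tendsto_of_tendsto' h1 (summable_eta.hasSum.tendsto_sum_nat.const_sub 1)
    fun k => competitive_ratio_le hc0 hA k

/-! ### Fractional matching -/

/-- The free amounts under the balancing fractional algorithm after `t` arrivals: each online vertex
fills its neighbours to a common level as far as possible. -/
noncomputable def fracFree {m n : ℕ} (G : Instance m n) : ℕ → Fin m → ℝ
  | 0 => fun _ => 1
  | t + 1 => fun x =>
    if h : t < n then
      if x ∈ G.nbhd ⟨t, h⟩ then max 0 ((∑ y ∈ G.nbhd ⟨t, h⟩, fracFree G t y - 1) / 2)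
      else fracFree G t x
    else fracFree G t x

section

variable {m n : ℕ} (G : Instance m n)

theorem fracFree_succ (j : Fin n) (x : Fin m) :
    fracFree G (j + 1) x = if x ∈ G.nbhd j then max 0 ((∑ y ∈ G.nbhd j, fracFree G j y - 1) / 2)
      else fracFree G j x := by
  simp [fracFree]

theorem fracFree_nonneg (t : ℕ) (x : Fin m) : 0 ≤ fracFree G t x := by
  induction t generalizing x with
  | zero => simp [fracFree]
  | succ t ih =>
    simp only [fracFree]
    split_ifs
    · exact le_max_left _ _
    · exact ih x
    · exact ih x

theorem fracFree_le_one (t : ℕ) (x : Fin m) : fracFree G t x ≤ 1 := by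
  induction t generalizing x with
  | zero => simp [fracFree]
  | succ t ih =>
    simp only [fracFree]
    split_ifs with ht hx
    · rcases Instance.nbhd_eq_of_mem hx with h | ⟨v, hv, h⟩
      · rw [h, Finset.sum_singleton]
        exact max_le zero_le_one (by linarith [ih x])
      · rw [h, Finset.sum_pair hv]
        exact max_le zero_le_one (by linarith [ih x, ih v])
    · exact ih x
    · exact ih x

theorem fracFree_succ_le (j : Fin n) (x : Fin m) : fracFree G (j + 1) x ≤ fracFree G j x := by
  have h0 := fracFree_nonneg G j
  have h1 := fracFree_le_one G j
  rw [fracFree_succ]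
  split_ifs with hx
  · refine max_le (h0 x) ?_
    rcases Instance.nbhd_eq_of_mem hx with h | ⟨v, hv, h⟩
    · rw [h, Finset.sum_singleton]
      linarith [h0 x, h1 x]
    · rw [h, Finset.sum_pair hv]
      linarith [h0 x, h1 v]
  · exact le_rfl

theorem fracFree_congr {G H : Instance m n} (t : ℕ)
    (h : ∀ k : Fin n, (k : ℕ) < t → G.nbhd k = H.nbhd k) : fracFree G t = fracFree H t := by
  induction t with
  | zero => rfl
  | succ t ih =>
    have ih := ih fun k hk => h k (by omega)
    funext x
    by_cases ht : t < n
    · simp only [fracFree, ht, dite_true, ih, h ⟨t, ht⟩ (Nat.lt_succ_self t)]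
    · simp only [fracFree, ht, dite_false, ih]

/-- The amount that an online vertex with two neighbours is matched. -/
theorem sum_fracFree_drop_pair {j : Fin n} {u v : Fin m} (huv : u ≠ v) (h : G.nbhd j = {u, v}) :
    ∑ x ∈ G.nbhd j, (fracFree G j x - fracFree G (j + 1) x) =
      min 1 (fracFree G j u + fracFree G j v) := by
  rw [h, Finset.sum_pair huv, fracFree_succ, fracFree_succ, if_pos (by simp [h]),
    if_pos (by simp [h]), h, Finset.sum_pair huv]
  rcases le_total 1 (fracFree G j u + fracFree G j v) with h1 | h1
  · rw [max_eq_right (by linarith), min_eq_left h1]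
    ring
  · rw [max_eq_left (by linarith), min_eq_right h1]
    ring

theorem sum_fracFree_drop_singleton {j : Fin n} {u : Fin m} (h : G.nbhd j = {u}) :
    ∑ x ∈ G.nbhd j, (fracFree G j x - fracFree G (j + 1) x) = fracFree G j u := by
  rw [h, Finset.sum_singleton, fracFree_succ, if_pos (by simp [h]), h, Finset.sum_singleton,
    max_eq_left (by linarith [fracFree_le_one G j u]), sub_zero]

theorem sum_fracFree_drop_univ (j : Fin n) :
    ∑ x, (fracFree G j x - fracFree G (j + 1) x) =
      ∑ x ∈ G.nbhd j, (fracFree G j x - fracFree G (j + 1) x) := by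
  refine (Finset.sum_subset (Finset.subset_univ _) fun x _ hx => ?_).symm
  rw [fracFree_succ, if_neg hx, sub_self]

theorem sum_fracFree_drop_time (x : Fin m) :
    ∑ j : Fin n, (fracFree G j x - fracFree G (j + 1) x) = 1 - fracFree G n x := by
  rw [Fin.sum_univ_eq_sum_range (fun t => fracFree G t x - fracFree G (t + 1) x) n,
    Finset.sum_range_sub' (fun t => fracFree G t x)]
  simp [fracFree]

end

/-- The balancing fractional algorithm. -/
noncomputable def balancing (m n : ℕ) : FracAlgorithm m n where
  run G j x := fracFree G j x - fracFree G (j + 1) x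
  nonneg G j x := sub_nonneg.2 (fracFree_succ_le G j x)
  supported G j x hx := by rw [fracFree_succ, if_neg hx, sub_self]
  online_sum_le_one G j := by
    rw [sum_fracFree_drop_univ]
    rcases (G.nbhd j).eq_empty_or_nonempty with h | ⟨u, hu⟩
    · simp [h]
    · rcases Instance.nbhd_eq_of_mem hu with h | ⟨v, hv, h⟩
      · rw [sum_fracFree_drop_singleton G h]
        exact fracFree_le_one G j u
      · rw [sum_fracFree_drop_pair G hv h]
        exact min_le_left _ _
  offline_sum_le_one G x := by
    rw [sum_fracFree_drop_time]
    linarith [fracFree_nonneg G n x]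
  online G H j h := by
    rw [fracFree_congr (G := G) (H := H) j fun k hk => h k (le_of_lt hk),
      fracFree_congr (G := G) (H := H) (j + 1) fun k hk => h k (Nat.lt_succ_iff.1 hk)]

theorem fracIsCompetitive_balancing : FracIsCompetitive (3 / 4) balancing := by
  intro m n G
  have hsum : ∑ j, ∑ i, (balancing m n).run G j i = m - ∑ x, fracFree G n x := by
    rw [Finset.sum_comm]
    simp only [balancing, sum_fracFree_drop_time]
    simp
  rw [hsum]
  have h0 := fracFree_nonneg G
  have h1 := fracFree_le_one G
  -- The branch `1 / 4 + x / 2` handles merges that use a full unit and leave `(p u + p v - 1) / 2`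
  -- at each end; the branch `x` gives the required `φ x ≤ x` and handles merges that exhaust both
  -- ends.
  refine mul_opt_le_of_potential G (φ := fun x => min x (1 / 4 + x / 2)) (p := fracFree G)
    (by norm_num) (fun x => rfl) (by norm_num) h0 (fun x _ => min_le_left _ _)
    (fun t x => ?_) (fun j x hx => by rw [fracFree_succ, if_neg hx]) (fun j u hu => ?_)
    (fun j u hu v hv huv => ?_)
  · exact (min_le_right _ _).trans (by linarith [h1 t x])
  · rcases Instance.nbhd_eq_of_mem hu with h | ⟨v, hv, h⟩
    · rw [sum_fracFree_drop_singleton G h]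
    · rw [sum_fracFree_drop_pair G hv h]
      exact le_min (h1 j u) (by linarith [h0 j v])
  · have hn := G.nbhd_eq_pair hu hv huv
    rw [sum_fracFree_drop_pair G huv hn, fracFree_succ, if_pos hu, hn, Finset.sum_pair huv]
    have a1 := min_le_left (fracFree G j u) (1 / 4 + fracFree G j u / 2)
    have a2 := min_le_right (fracFree G j u) (1 / 4 + fracFree G j u / 2)
    have b1 := min_le_left (fracFree G j v) (1 / 4 + fracFree G j v / 2)
    have b2 := min_le_right (fracFree G j v) (1 / 4 + fracFree G j v / 2)
    rcases le_total 1 (fracFree G j u + fracFree G j v) with h | h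
    · rw [min_eq_left h, max_eq_right (by linarith)]
      exact le_min (by linarith) (by linarith [h1 j u, h1 j v])
    · rw [min_eq_right h, max_eq_left (by linarith)]
      exact le_min (by linarith) (by linarith)

/-- First an online vertex adjacent to both offline vertices arrives, then one adjacent to `i`
only. -/
def pendantInstance (i : Fin 2) : Instance 2 2 where
  nbhd j := if j = 0 then Finset.univ else {i}
  degree_le_two j := by split_ifs <;> simp

theorem two_le_opt_pendantInstance (i : Fin 2) : 2 ≤ opt (pendantInstance i) := by
  have hM : IsMatching (pendantInstance i) fun j => some (if j = 0 then i + 1 else i) := by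
    refine ⟨fun j x hx => ?_, fun j k x hj hk => ?_⟩
    · rw [← Option.some.inj hx, pendantInstance]
      split_ifs with h <;> simp [h]
    · have h := (Option.some.inj hj).trans (Option.some.inj hk).symm
      revert h
      fin_cases i <;> fin_cases j <;> fin_cases k <;> simp
  have := hM.size_le_opt
  simpa [size] using this

/-- The first arrival looks the same in both pendant instances. Whatever it puts on `i` is lost to
the second vertex, so the two totals add up to at most 2 plus the weight of the first arrival, hence
at most 3, while the optima add up to at least 4. -/
theorem not_fracIsCompetitive_of_lt {c : ℝ} (hc : 3 / 4 < c) (A : ∀ m n : ℕ, FracAlgorithm m n) :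
    ¬ FracIsCompetitive c A := by
  intro hA
  set D := A 2 2
  have hfirst : D.run (pendantInstance 0) 0 = D.run (pendantInstance 1) 0 := by
    refine D.online _ _ 0 fun k hk => ?_
    have : k = 0 := Fin.le_zero_iff.1 hk
    subst this
    simp [pendantInstance]
  have hlow : ∀ i, 2 * c ≤ ∑ j, ∑ x, D.run (pendantInstance i) j x := fun i => by
    refine le_trans ?_ (hA 2 2 (pendantInstance i))
    have : (2 : ℝ) ≤ opt (pendantInstance i) := by exact_mod_cast two_le_opt_pendantInstance i
    nlinarith
  have s0 := D.supported (pendantInstance 0) 1 1 (by simp [pendantInstance])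
  have s1 := D.supported (pendantInstance 1) 1 0 (by simp [pendantInstance])
  have l0 := hlow 0
  have l1 := hlow 1
  have o0 := D.offline_sum_le_one (pendantInstance 0) 0
  have o1 := D.offline_sum_le_one (pendantInstance 1) 1
  have f0 := D.online_sum_le_one (pendantInstance 1) 0
  simp only [Fin.sum_univ_two, hfirst, s0, s1] at l0 l1 o0 o1 f0
  linarith

end OnlineMatching

theorem theorem1 :
    -- Half-Half is `η`-competitive
    OnlineMatching.IsCompetitive OnlineMatching.eta OnlineMatching.halfHalf ∧
    -- no randomized online algorithm is better than `η`-competitive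
    (∀ c : ℝ, OnlineMatching.eta < c →
      ¬ ∃ A : ∀ m n : ℕ, OnlineMatching.RandAlgorithm m n, OnlineMatching.IsCompetitive c A) ∧
    -- numerical value: `η` rounds to `0.717772`
    |OnlineMatching.eta - 0.717772| < 0.0000005 ∧
    -- separation: the optimal competitive ratio of fractional online algorithms is `3 / 4 > η`
    (∃ A : ∀ m n : ℕ, OnlineMatching.FracAlgorithm m n,
      OnlineMatching.FracIsCompetitive (3 / 4) A) ∧
    (∀ c : ℝ, 3 / 4 < c →
      ¬ ∃ A : ∀ m n : ℕ, OnlineMatching.FracAlgorithm m n,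
        OnlineMatching.FracIsCompetitive c A) ∧
    OnlineMatching.eta < 3 / 4 := by
  refine ⟨OnlineMatching.isCompetitive_halfHalf,
    fun c hc ⟨A, hA⟩ => OnlineMatching.not_isCompetitive_of_eta_lt hc A hA,
    OnlineMatching.abs_eta_sub_lt, ⟨_, OnlineMatching.fracIsCompetitive_balancing⟩,
    fun c hc ⟨A, hA⟩ => OnlineMatching.not_fracIsCompetitive_of_lt hc A hA, ?_⟩
  have := (abs_lt.1 OnlineMatching.abs_eta_sub_lt).2
  norm_num at this
  linarith
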